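/- **Setting.** Let $a_n>0$ and $b_n\in\mathbb R$ $(n\ge 1)$, and let $J$ be the Jacobi matrix with diagonal entries $b_1,b_2,\dots$ and off-diagonal entries $a_1,a_2,\dots$, acting on $\ell^2(\mathbb Z_+)$ with domain $\{f\in\ell^2: Jf\in\ell^2\}$. Assume that $J$ is self-adjoint (this is automatic if the parameters are bounded). Let $J_0$ be the Jacobi matrix with $a_n\equiv 1$, $b_n\equiv 0$. For $E$ in the resolvent set of $J$ let $m(E)=\langle\delta_1,(J-E)^{-1}\delta_1\rangle$. The $M$-function of $J$ is $M(z)=-m(z+z^{-1})$, defined for those $z\in\mathbb D\setminus\{0\}$, $\mathbb D=\{|z|<1\}$, for which $z+z^{-1}$ lies in the resolvent set of $J$. If $M$ is (the restriction of) a rational function, that rational function is also denoted by $M$. If $M$ is rational, and all its poles in $\overline{\mathbb D}$ are simple and real, let $z_1,\dots,z_N$ be the poles of $M$ in $\mathbb D$ and define the Jost function by $$u(z)=\prod_{k=1}^N b(z,z_k)\,\exp\left(\int_0^{2\pi}\frac{e^{i\theta}+z}{e^{i\theta}-z}\,\log\left(\frac{\sin\theta}{\operatorname{Im}M(e^{i\theta})}\right)\frac{d\theta}{4\pi}\right),\qquad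 z\in\mathbb D,$$ where $b(z,w)=\frac{|w|}{w}\,\frac{w-z}{1-\bar w z}$ for $w\neq0$ and $b(z,0)=z$. If $u$ is a polynomial, then $M$ is said to have canonical weight at a pole $z_0\in\mathbb D$ of $M$ if $u'(z_0)u(z_0^{-1})\neq 0$ and $$\lim_{z\to z_0,\ z\ne z_0}(z-z_0)M(z)=(z_0-z_0^{-1})\,[u'(z_0)\,u(z_0^{-1})]^{-1}.$$ **Theorem.** $J-J_0$ has finite rank if and only if the following three conditions hold: (i) $M$ is rational, and all its poles in $\overline{\mathbb D}$ are simple and lie in $\mathbb R$; (ii) the Jost function $u$ is a polynomial (that is, it coincides on $\mathbb D$ with a polynomial); (iii) $M$ has canonical weight at each $z_0\in\mathbb D$ which is a pole of $M$. -/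

import Mathlib

open scoped Topology Polynomial

/-- A (half-line) Jacobi matrix: the parameters `a₁, a₂, … > 0` and `b₁, b₂, … ∈ ℝ`.
Indices are shifted by one, so `a n` is `aₙ₊₁` and `b n` is `bₙ₊₁`. -/
structure JacobiMatrix where
  a : ℕ → ℝ
  b : ℕ → ℝ
  a_pos : ∀ n, 0 < a n

/-- The Hilbert space `ℓ²(ℤ₊)`. -/
abbrev SeqHilbert : Type := lp (fun _ : ℕ => ℂ) 2

/-- The vector `δ₁` (at index `0` in the shifted numbering). -/
noncomputable def deltaOne : SeqHilbert := lp.single 2 0 1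

namespace JacobiMatrix

/-- The tridiagonal matrix with diagonal `b` and off-diagonals `a`, applied to a sequence. -/
def action (J : JacobiMatrix) (f : ℕ → ℂ) : ℕ → ℂ
  | 0 => (J.b 0 : ℂ) * f 0 + (J.a 0 : ℂ) * f 1
  | n + 1 => (J.a n : ℂ) * f n + (J.b (n + 1) : ℂ) * f (n + 1) + (J.a (n + 1) : ℂ) * f (n + 2)

theorem action_add (J : JacobiMatrix) (f g : ℕ → ℂ) :
    J.action (f + g) = J.action f + J.action g := by
  funext n
  cases n <;> simp only [action, Pi.add_apply] <;> ring

theorem action_smul (J : JacobiMatrix) (c : ℂ) (f : ℕ → ℂ) :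
    J.action (c • f) = c • J.action f := by
  funext n
  cases n <;> simp only [action, Pi.smul_apply, smul_eq_mul] <;> ring

/-- The Jacobi matrix as an operator on `ℓ²(ℤ₊)`, with its natural (maximal) domain of all
`f ∈ ℓ²` with `Jf ∈ ℓ²`. If the parameters are bounded, the domain is all of `ℓ²`. -/
noncomputable def operator (J : JacobiMatrix) : SeqHilbert →ₗ.[ℂ] SeqHilbert where
  domain :=
    { carrier := {f | Memℓp (J.action f) 2}
      add_mem' := by
        intro f g hf hg
        have h := hf.add hg
        rw [← action_add] at h
        exact h
      zero_mem' := by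
        have h : J.action ((0 : SeqHilbert) : ℕ → ℂ) = 0 := by
          funext n
          cases n <;> simp [action]
        change Memℓp (J.action ((0 : SeqHilbert) : ℕ → ℂ)) 2
        rw [h]
        exact zero_memℓp
      smul_mem' := by
        intro c f hf
        have h := hf.const_smul c
        rw [← action_smul] at h
        exact h }
  toFun :=
    { toFun := fun f => ⟨J.action (f : SeqHilbert), f.2⟩
      map_add' := fun f g => Subtype.ext (J.action_add (f : SeqHilbert) (g : SeqHilbert))
      map_smul' := fun c f => Subtype.ext (J.action_smul c (f : SeqHilbert)) }

/-- The free Jacobi matrix `J₀`: all `aₙ = 1`, all `bₙ = 0`. -/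
def free : JacobiMatrix where
  a := fun _ => 1
  b := fun _ => 0
  a_pos := fun _ => one_pos

/-- `J - J₀` has finite rank. -/
def FiniteRankPerturbation (J : JacobiMatrix) : Prop :=
  FiniteDimensional ℂ (LinearMap.range (J.operator - free.operator).toFun)

/-- The resolvent set of `J`: those `E` for which `J - E` maps the domain of `J` bijectively
onto `ℓ²`. (`J` is a closed operator, so the inverse is then bounded.) -/
def resolventSet (J : JacobiMatrix) : Set ℂ :=
  {E | Function.Bijective fun f : J.operator.domain => J.operator f - E • (f : SeqHilbert)}

open Classical in
/-- `m(E) = ⟨δ₁, (J - E)⁻¹ δ₁⟩` for `E` in the resolvent set of `J` (and `0` elsewhere). -/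
noncomputable def m (J : JacobiMatrix) (E : ℂ) : ℂ :=
  if h : E ∈ J.resolventSet then
    inner ℂ deltaOne (((Equiv.ofBijective _ h).symm deltaOne : J.operator.domain) : SeqHilbert)
  else 0

/-- The `M`-function `M(z) = -m(z + z⁻¹)`, for `z ∈ 𝔻 \ {0}` with `z + z⁻¹` in the
resolvent set of `J`. -/
noncomputable def M (J : JacobiMatrix) (z : ℂ) : ℂ := -J.m (z + z⁻¹)

/-- The `M`-function of `J` is (the restriction to its domain of definition of) the rational
function `r`. -/
def MFunctionIs (J : JacobiMatrix) (r : RatFunc ℂ) : Prop :=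
  ∀ z : ℂ, ‖z‖ < 1 → z ≠ 0 → z + z⁻¹ ∈ J.resolventSet → J.M z = r.eval (RingHom.id ℂ) z

end JacobiMatrix

/-- `z` is a pole of the rational function `r` (written in lowest terms). -/
def IsPole (r : RatFunc ℂ) (z : ℂ) : Prop := r.denom.IsRoot z

/-- Every pole of `r` in the closed unit disk is real and simple. -/
def PolesInDiskRealSimple (r : RatFunc ℂ) : Prop :=
  ∀ z : ℂ, ‖z‖ ≤ 1 → IsPole r z → z.im = 0 ∧ r.denom.rootMultiplicity z = 1

/-- The Blaschke factor `b(z, w)`, normalized by `b(0, w) = |w| > 0` for `w ≠ 0`. -/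
noncomputable def blaschkeFactor (z w : ℂ) : ℂ :=
  if w = 0 then z else ((‖w‖ : ℂ) / w) * ((w - z) / (1 - starRingEnd ℂ w * z))

/-- The finite set of poles of `r` in the open unit disk. -/
noncomputable def diskPoles (r : RatFunc ℂ) : Finset ℂ :=
  r.denom.roots.toFinset.filter fun w => ‖w‖ < 1

/-- The Jost function `u(z)`, `z ∈ 𝔻`, determined by the rational `M`-function `r`: the Blaschke
product over the poles in `𝔻` times
`exp (∫ ((e^{iθ} + z) / (e^{iθ} - z)) log (sin θ / Im M(e^{iθ})) dθ / 4π)`. -/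
noncomputable def jostFunction (r : RatFunc ℂ) (z : ℂ) : ℂ :=
  (∏ w ∈ diskPoles r, blaschkeFactor z w) *
    Complex.exp (∫ θ in (0 : ℝ)..(2 * Real.pi),
      ((Complex.exp (θ * Complex.I) + z) / (Complex.exp (θ * Complex.I) - z)) *
        ((Real.log (Real.sin θ / (r.eval (RingHom.id ℂ) (Complex.exp (θ * Complex.I))).im) : ℝ) : ℂ)
          / ((4 * Real.pi : ℝ) : ℂ))

/-- The `M`-function `r`, with polynomial Jost function `u`, has canonical weight at `z₀`:
`lim (z - z₀) M(z) = (z₀ - z₀⁻¹) [u'(z₀) u(z₀⁻¹)]⁻¹`, where the bracket is nonzero. -/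
def HasCanonicalWeight (r : RatFunc ℂ) (u : ℂ[X]) (z₀ : ℂ) : Prop :=
  u.derivative.eval z₀ * u.eval z₀⁻¹ ≠ 0 ∧
    Filter.Tendsto (fun z => (z - z₀) * r.eval (RingHom.id ℂ) z) (𝓝[≠] z₀)
      (𝓝 ((z₀ - z₀⁻¹) * (u.derivative.eval z₀ * u.eval z₀⁻¹)⁻¹))

/-! Write `E = z + z⁻¹`. Everything rests on the Wronskian of solutions of the three-term recurrence
being constant in `k`.

If `J - J₀` has finite rank, the parameters are eventually free (`finiteRankPerturbation_iff`). The
Jost solution, equal to `zᵏ` for large `k`, is continued backwards to indices `0` and `1`, where it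
gives real polynomials `U` and `V` (`exists_jost_pair`). It decays for `|z| < 1`, so `M = V / U`,
and comparing it with its image under `z ↦ z⁻¹` gives `V(z)U(z⁻¹) - U(z)V(z⁻¹) = z - z⁻¹`. On the
circle this reads `Im M = sin θ / |U|²`, so the integral defining the Jost function only sees `log
|U|`; the Poisson formula then recovers `U` itself (`blaschke_mul_exp_herglotzIntegral`). At a zero
of `U` in the disk the same relation computes the residue, which is the canonical weight. Simplicity
of the poles comes from `|m(E)| ≤ 1 / |Im E|` inside the disk and from the Wronskian at `±1`.

Conversely, let `M = N / D` in lowest terms. On the circle `|u|² Im M = sin θ` (`norm_jost_sq`), and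
this extends to `u(z)u(z⁻¹)(N(z)D(z⁻¹) - N(z⁻¹)D(z)) = (z - z⁻¹)D(z)D(z⁻¹)` for all `z ≠ 0`. The
canonical weights forbid poles at both `w` and `w⁻¹` with `|w| > 1`, and this is what makes `D`
divide `u` (`denom_dvd_of_canonical`). With `u = D e`, the polynomials `u` and `e N` have quotient
`M` and Wronskian `z - z⁻¹`. The recurrence started from them produces `zᵏ Pₖ(z)`, where `Pₖ` is a
polynomial with `Pₖ(0) ≠ 0`, by decay of the resolvent vector (`exists_reduced_polynomial`). The
Wronskian makes `deg Pₖ` drop by at least `2` until the `Pₖ` are constant, and from then on the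
recurrence forces `a = 1`, `b = 0` (`eventually_free_of_wronskian`). -/

section

/-! ### Poisson and Herglotz integrals of the log-modulus of a polynomial. -/

open Complex Metric Real Filter Polynomial

/-- The Herglotz integral `∫ (ζ + z) / (ζ - z) g(ζ) dθ / 2π` over the unit circle. -/
noncomputable def herglotzIntegral (g : ℂ → ℝ) (z : ℂ) : ℂ :=
  circleAverage (fun ζ => herglotzRieszKernel 0 z ζ • (g ζ : ℂ)) 0 1

theorem circleIntegrable_log_norm_eval (p : ℂ[X]) :
    CircleIntegrable (fun ζ => Real.log ‖p.eval ζ‖) 0 1 :=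
  MeromorphicOn.circleIntegrable_log_norm (f := fun ζ => p.eval ζ) (fun z _ =>
    (p.differentiable.analyticAt z).meromorphicAt)

theorem CircleIntegrable.complex_ofReal {g : ℂ → ℝ} (hg : CircleIntegrable g 0 1) :
    CircleIntegrable (fun ζ => (g ζ : ℂ)) 0 1 := by
  simp only [CircleIntegrable, intervalIntegrable_iff] at hg ⊢
  exact Complex.ofRealCLM.integrable_comp hg

theorem CircleIntegrable.herglotz_smul {g : ℂ → ℝ} (hg : CircleIntegrable g 0 1) {z : ℂ}
    (hz : ‖z‖ < 1) : CircleIntegrable (fun ζ => herglotzRieszKernel 0 z ζ • (g ζ : ℂ)) 0 1 :=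
  (CircleIntegrable.complex_ofReal hg).continuousOn_smul
    (continuousOn_herglotzRieszKernel_sphere (by simpa using hz))

theorem CircleIntegrable.poisson_smul {g : ℂ → ℝ} (hg : CircleIntegrable g 0 1) {z : ℂ}
    (hz : ‖z‖ < 1) : CircleIntegrable ((re ∘ herglotzRieszKernel 0 z) • g) 0 1 :=
  hg.continuousOn_smul (Complex.continuous_re.comp_continuousOn
    (continuousOn_herglotzRieszKernel_sphere (by simpa using hz)))

theorem eventually_codiscreteWithin_of_finite {P : ℂ → Prop} {S s : Set ℂ} (hS : S.Finite)
    (h : ∀ ζ ∈ s, ζ ∉ S → P ζ) : ∀ᶠ ζ in codiscreteWithin s, P ζ := by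
  have h1 := compl_finite_mem_codiscreteWithin (s := s) hS
  have h2 : s ∈ codiscreteWithin s := self_mem_codiscreteWithin s
  filter_upwards [h1, h2] with ζ hζ hζ' using h ζ hζ' hζ

theorem Polynomial.setOf_isRoot_finite {p : ℂ[X]} (hp : p ≠ 0) : {ζ | p.eval ζ = 0}.Finite :=
  (p.roots.toFinset.finite_toSet).subset fun ζ hζ => by simpa [hp] using hζ

/-- The Poisson formula for `log ‖ζ - w‖`, with `w` outside the open disk. -/
theorem poisson_log_norm_sub {z w : ℂ} (hz : ‖z‖ < 1) (hw : 1 ≤ ‖w‖) :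
    circleAverage ((re ∘ herglotzRieszKernel 0 z) • (fun ζ => Real.log ‖ζ - w‖)) 0 1 =
      Real.log ‖z - w‖ := by
  -- For `‖w‖ = 1` the logarithm is singular on the contour; for `‖w‖ > 1` it is harmonic near the
  -- closed disk.
  rcases hw.eq_or_lt with h | h
  · exact circleAverage_re_herglotzRieszKernel_mul_log (by simp [← h]) (by simpa using hz)
  · refine InnerProductSpace.HarmonicOnNhd.circleAverage_re_herglotzRieszKernel_smul
      (fun x hx => ?_) (by simpa using hz)
    refine AnalyticAt.harmonicAt_log_norm (f := fun ζ => ζ - w) (by fun_prop) ?_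
    intro h0
    rw [sub_eq_zero] at h0
    subst h0
    simp at hx
    linarith

/-- Split off one root at a time: each linear factor is covered by `poisson_log_norm_sub`, and zeros
on the circle are allowed. -/
theorem poisson_log_norm_eval {z : ℂ} (hz : ‖z‖ < 1) (q : ℂ[X])
    (hq : ∀ w, ‖w‖ < 1 → q.eval w ≠ 0) :
    circleAverage ((re ∘ herglotzRieszKernel 0 z) • (fun ζ => Real.log ‖q.eval ζ‖)) 0 1 =
      Real.log ‖q.eval z‖ := by
  induction hn : q.natDegree generalizing q with
  | zero =>
    rw [Polynomial.eq_C_of_natDegree_eq_zero hn]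
    simp only [eval_C]
    exact InnerProductSpace.HarmonicOnNhd.circleAverage_re_herglotzRieszKernel_smul
      (fun x _ => InnerProductSpace.harmonicAt_const _ ) (by simpa using hz)
  | succ n ih =>
    have hq0 : q ≠ 0 := by rintro rfl; simp at hn
    obtain ⟨w, hw⟩ := IsAlgClosed.exists_root q (by
      rw [Polynomial.degree_eq_natDegree hq0, hn]; exact_mod_cast n.succ_ne_zero)
    obtain ⟨p, rfl⟩ := Polynomial.dvd_iff_isRoot.2 hw
    have hp0 : p ≠ 0 := right_ne_zero_of_mul hq0
    have hw1 : 1 ≤ ‖w‖ := by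
      by_contra! h
      exact hq w h hw
    have hp : ∀ x, ‖x‖ < 1 → p.eval x ≠ 0 := fun x hx h => hq x hx (by simp [h])
    have hd : p.natDegree = n := by
      rw [natDegree_mul (X_sub_C_ne_zero w) hp0, natDegree_X_sub_C] at hn
      omega
    have key := ih p hp hd
    have h1 : CircleIntegrable (fun ζ => Real.log ‖ζ - w‖) 0 1 :=
      circleIntegrable_log_norm_sub_const 1
    have h2 := circleIntegrable_log_norm_eval p
    have hsplit : circleAverage ((re ∘ herglotzRieszKernel 0 z) •
          (fun ζ => Real.log ‖((X - C w) * p).eval ζ‖)) 0 1 =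
        circleAverage ((re ∘ herglotzRieszKernel 0 z) • (fun ζ => Real.log ‖ζ - w‖) +
          (re ∘ herglotzRieszKernel 0 z) • (fun ζ => Real.log ‖p.eval ζ‖)) 0 1 := by
      -- The logarithm of the product splits only away from the roots, a finite set that the average
      -- ignores.
      refine circleAverage_congr_codiscreteWithin ?_ one_ne_zero
      refine eventually_codiscreteWithin_of_finite (setOf_isRoot_finite hq0) fun ζ _ hζ => ?_
      simp only [Set.mem_ofPred_eq, eval_mul, mul_eq_zero, not_or, eval_sub, eval_X, eval_C] at hζ
      change _ * Real.log _ = _ * Real.log _ + _ * Real.log _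
      rw [eval_mul, eval_sub, eval_X, eval_C, norm_mul, Real.log_mul (by simpa using hζ.1) (by simpa using hζ.2)]
      ring
    rw [hsplit, circleAverage_add (CircleIntegrable.poisson_smul h1 hz)
      (CircleIntegrable.poisson_smul h2 hz), key, poisson_log_norm_sub hz hw1]
    have hz1 : z - w ≠ 0 := fun h => by rw [sub_eq_zero] at h; subst h; linarith
    simp only [eval_mul, eval_sub, eval_X, eval_C, norm_mul]
    rw [Real.log_mul (by simpa using hz1) (by simpa using hp z hz)]

theorem herglotzIntegral_zero (g : ℂ → ℝ) : (herglotzIntegral g 0).im = 0 := by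
  have h : herglotzIntegral g 0 = circleAverage (fun ζ => (g ζ : ℂ)) 0 1 := by
    refine circleAverage_congr_sphere fun ζ hζ => ?_
    have : ζ ≠ 0 := by rintro rfl; simp at hζ
    simp [herglotzRieszKernel_def, this]
  rw [h, circleAverage_def, intervalIntegral.integral_ofReal]
  simp

/-- A polynomial without zeros in the open disk is recovered from its modulus on the circle. -/
theorem exp_herglotzIntegral_log_norm_eval {q : ℂ[X]} (hq : ∀ w, ‖w‖ < 1 → q.eval w ≠ 0)
    {z : ℂ} (hz : ‖z‖ < 1) :
    Complex.exp (herglotzIntegral (fun ζ => Real.log ‖q.eval ζ‖) z) =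
      (‖q.eval 0‖ / q.eval 0) * q.eval z := by
  set T := herglotzIntegral (fun ζ => Real.log ‖q.eval ζ‖) with hT
  have hint := circleIntegrable_log_norm_eval q
  have hdiff : DifferentiableOn ℂ T (ball 0 1) :=
    differentiableOn_circleAverage_herglotzRieszKernel_smul (CircleIntegrable.complex_ofReal hint)
  -- The quotient is holomorphic of modulus `1`, hence constant by the maximum principle; the
  -- constant is read off at `0`, where `T` is real.
  have hnorm : ∀ x ∈ ball (0 : ℂ) 1, ‖Complex.exp (T x) / q.eval x‖ = 1 := by
    intro x hx
    have hx' : ‖x‖ < 1 := by simpa using hx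
    have hre : (T x).re = Real.log ‖q.eval x‖ := by
      rw [← poisson_log_norm_eval hx' q hq]
      exact re_circleAverage_herglotzRieszKernel_smul hint hx
    have hpos : 0 < ‖q.eval x‖ := norm_pos_iff.2 (hq x hx')
    rw [norm_div, Complex.norm_exp, hre, Real.exp_log hpos, div_self hpos.ne']
  have hconst := Complex.eqOn_of_isPreconnected_of_isMaxOn_norm
    (f := fun x => Complex.exp (T x) / q.eval x) (convex_ball (0 : ℂ) 1).isPreconnected isOpen_ball
    (hdiff.cexp.div (Polynomial.differentiable q).differentiableOn
      fun x hx => hq x (by simpa using hx)) (mem_ball_self one_pos)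
    (fun x hx => by
      change ‖Complex.exp (T x) / q.eval x‖ ≤ ‖Complex.exp (T 0) / q.eval 0‖
      rw [hnorm x hx, hnorm 0 (mem_ball_self one_pos)])
  have hz' : z ∈ ball (0 : ℂ) 1 := by simpa using hz
  have h1 := hconst hz'
  have h0 : q.eval 0 ≠ 0 := hq 0 (by simp)
  have hre0 : (T 0).re = Real.log ‖q.eval 0‖ := by
    rw [← poisson_log_norm_eval (by simp) q hq]
    exact re_circleAverage_herglotzRieszKernel_smul hint (mem_ball_self one_pos)
  have hT0 : T 0 = (Real.log ‖q.eval 0‖ : ℝ) :=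
    Complex.ext (by simpa using hre0) (by simpa using herglotzIntegral_zero _)
  simp only [Function.const_apply, hT0] at h1
  rw [← Complex.ofReal_exp, Real.exp_log (norm_pos_iff.2 h0), div_eq_iff (hq z hz)] at h1
  exact h1

theorem norm_one_sub_conj_mul {w ζ : ℂ} (hζ : ‖ζ‖ = 1) :
    ‖1 - (starRingEnd ℂ) w * ζ‖ = ‖ζ - w‖ := by
  have h : 1 - (starRingEnd ℂ) w * ζ = ζ * (starRingEnd ℂ) (ζ - w) := by
    rw [map_sub, mul_sub, Complex.mul_conj, Complex.normSq_eq_norm_sq, hζ]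
    push_cast
    ring
  rw [h, norm_mul, hζ, one_mul, RCLike.norm_conj]

/-- Reflecting the zeros in the open disk across the circle. -/
theorem exists_zeroFree_norm_eq {p : ℂ[X]} (hp : p ≠ 0) :
    ∃ q : ℂ[X], (∀ w, ‖w‖ < 1 → q.eval w ≠ 0) ∧ ∀ ζ, ‖ζ‖ = 1 → ‖q.eval ζ‖ = ‖p.eval ζ‖ := by
  induction hn : p.natDegree generalizing p with
  | zero =>
    rw [Polynomial.eq_C_of_natDegree_eq_zero hn] at hp ⊢
    exact ⟨_, fun w _ => by simpa using hp, fun ζ _ => rfl⟩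
  | succ n ih =>
    obtain ⟨w, hw⟩ := IsAlgClosed.exists_root p (by
      rw [Polynomial.degree_eq_natDegree hp, hn]; exact_mod_cast n.succ_ne_zero)
    obtain ⟨p', rfl⟩ := Polynomial.dvd_iff_isRoot.2 hw
    have hp0 : p' ≠ 0 := right_ne_zero_of_mul hp
    have hd : p'.natDegree = n := by
      rw [natDegree_mul (X_sub_C_ne_zero w) hp0, natDegree_X_sub_C] at hn
      omega
    obtain ⟨q, hq, hq'⟩ := ih hp0 hd
    by_cases hw1 : ‖w‖ < 1
    · refine ⟨(1 - C (starRingEnd ℂ w) * X) * q, fun x hx h => ?_, fun ζ hζ => ?_⟩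
      · simp only [eval_mul, eval_sub, eval_one, eval_C, eval_X, mul_eq_zero] at h
        rcases h with h | h
        · have h1 : ‖(starRingEnd ℂ) w * x‖ = 1 := by
            rw [← sub_eq_zero.1 h, norm_one]
          rw [norm_mul, RCLike.norm_conj] at h1
          nlinarith [norm_nonneg w, norm_nonneg x]
        · exact hq x hx h
      · simp [hq' ζ hζ, norm_one_sub_conj_mul hζ]
    · refine ⟨(X - C w) * q, fun x hx h => ?_, fun ζ hζ => by simp [hq' ζ hζ]⟩
      simp only [eval_mul, eval_sub, eval_C, eval_X, mul_eq_zero] at h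
      rcases h with h | h
      · rw [sub_eq_zero] at h; subst h; exact hw1 hx
      · exact hq x hx h

theorem jostFunction_eq (r : RatFunc ℂ) (z : ℂ) :
    jostFunction r z = (∏ w ∈ diskPoles r, blaschkeFactor z w) *
      Complex.exp (herglotzIntegral
        (fun ζ => Real.log (ζ.im / (r.eval (RingHom.id ℂ) ζ).im)) z / 2) := by
  rw [jostFunction, herglotzIntegral, circleAverage_def]
  congr 2
  rw [Complex.real_smul, ← intervalIntegral.integral_const_mul, ← intervalIntegral.integral_div]
  refine intervalIntegral.integral_congr fun θ _ => ?_
  have him : (Complex.exp (θ * I)).im = Real.sin θ := Complex.exp_ofReal_mul_I_im θ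
  simp only [herglotzRieszKernel_def, sub_zero, circleMap, ofReal_one, one_mul, zero_add, him,
    smul_eq_mul]
  push_cast
  ring

/-- The exceptional set absorbs the points where the default value of `Real.log` at `0` or of
division by `0` spoils an identity. -/
theorem herglotzIntegral_congr {g h : ℂ → ℝ} {S : Set ℂ} (hS : S.Finite)
    (hgh : ∀ ζ, ‖ζ‖ = 1 → ζ ∉ S → g ζ = h ζ) (z : ℂ) :
    herglotzIntegral g z = herglotzIntegral h z := by
  refine circleAverage_congr_codiscreteWithin ?_ one_ne_zero
  refine eventually_codiscreteWithin_of_finite hS fun ζ hζ hζ' => ?_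
  simp [hgh ζ (by simpa using hζ) hζ']

theorem herglotzIntegral_add {g h : ℂ → ℝ} (hg : CircleIntegrable g 0 1)
    (hh : CircleIntegrable h 0 1) {z : ℂ} (hz : ‖z‖ < 1) :
    herglotzIntegral (fun ζ => g ζ + h ζ) z = herglotzIntegral g z + herglotzIntegral h z := by
  rw [herglotzIntegral, herglotzIntegral, herglotzIntegral,
    ← circleAverage_add (CircleIntegrable.herglotz_smul hg hz)
      (CircleIntegrable.herglotz_smul hh hz)]
  congr 1
  funext ζ
  simp [mul_add]

end

/-! ### Resolvent of a self-adjoint Jacobi operator off the real axis. -/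

section

theorem memℓp_of_eventually_zero {g : ℕ → ℂ} {N : ℕ} (h : ∀ n, N ≤ n → g n = 0) : Memℓp g 2 := by
  refine memℓp_gen (summable_of_ne_finset_zero (s := Finset.range N) fun n hn => ?_)
  rw [h n (by simpa using hn)]
  simp

namespace JacobiMatrix

variable (J : JacobiMatrix)

theorem action_eq_zero {f : ℕ → ℂ} {N : ℕ} (h : ∀ n, N ≤ n → f n = 0) :
    ∀ n, N + 1 ≤ n → J.action f n = 0 := by
  intro n hn
  obtain ⟨k, rfl⟩ : ∃ k, n = k + 1 := ⟨n - 1, by omega⟩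
  simp [action, h k (by omega), h (k + 1) (by omega), h (k + 2) (by omega)]

theorem action_conj (f : ℕ → ℂ) : J.action (star f) = star (J.action f) := by
  funext n
  cases n <;> simp [action]

/-- The equation `J x = E x + g`, for sequences `x, g` in `ℓ²`. -/
def Solves (E : ℂ) (x g : SeqHilbert) : Prop := J.action x = (g : ℕ → ℂ) + E • (x : ℕ → ℂ)

variable {J} {E : ℂ} {x y g : SeqHilbert}

theorem Solves.mem_domain (h : J.Solves E x g) : x ∈ J.operator.domain := by
  change Memℓp (J.action x) 2
  rw [h]
  exact (lp.memℓp g).add ((lp.memℓp x).const_smul E)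

theorem solves_iff (f : J.operator.domain) :
    J.operator f - E • (f : SeqHilbert) = g ↔ J.Solves E f g := by
  rw [sub_eq_iff_eq_add, Solves]
  exact ⟨fun h => congrArg (fun v : SeqHilbert => (v : ℕ → ℂ)) h, fun h => lp.ext h⟩

theorem mem_resolventSet_iff : E ∈ J.resolventSet ↔ ∀ g, ∃! x, J.Solves E x g := by
  rw [resolventSet, Set.mem_ofPred_eq, Function.bijective_iff_existsUnique]
  refine forall_congr' fun g => ?_
  constructor
  · rintro ⟨f, hf, huniq⟩
    refine ⟨f, (solves_iff f).1 hf, fun y hy => ?_⟩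
    have := huniq ⟨y, hy.mem_domain⟩ ((solves_iff (J := J) (E := E) (g := g) ⟨y, hy.mem_domain⟩).2 hy)
    rw [← this]
  · rintro ⟨x, hx, huniq⟩
    refine ⟨⟨x, hx.mem_domain⟩, (solves_iff (J := J) (E := E) (g := g) ⟨x, hx.mem_domain⟩).2 hx,
      fun f hf => Subtype.ext (huniq f ((solves_iff f).1 hf))⟩

theorem m_eq (hE : E ∈ J.resolventSet) (hx : J.Solves E x deltaOne) : J.m E = x 0 := by
  have hb : Function.Bijective fun f : J.operator.domain => J.operator f - E • (f : SeqHilbert) := hE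
  rw [m, dif_pos hE]
  have : (Equiv.ofBijective _ hb).symm deltaOne = ⟨x, hx.mem_domain⟩ := by
    rw [Equiv.symm_apply_eq]
    exact ((solves_iff (J := J) (E := E) (g := deltaOne) ⟨x, hx.mem_domain⟩).2 hx).symm
  rw [this]
  change inner ℂ (lp.single 2 0 1) x = x 0
  rw [lp.inner_single_left]
  simp

theorem formalAdjoint (hJ : IsSelfAdjoint J.operator) (f g : J.operator.domain) :
    inner ℂ (J.operator f) (g : SeqHilbert) = inner ℂ (f : SeqHilbert) (J.operator g) := by
  have h := LinearPMap.adjoint_isFormalAdjoint (T := J.operator) hJ.dense_domain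
  rw [LinearPMap.isSelfAdjoint_def.1 hJ] at h
  exact h f g

theorem inner_operator_im (hJ : IsSelfAdjoint J.operator) (f : J.operator.domain) :
    (inner ℂ (f : SeqHilbert) (J.operator f)).im = 0 := by
  have h := formalAdjoint hJ f f
  rw [← inner_conj_symm] at h
  exact Complex.conj_eq_iff_im.1 h

/-- The imaginary part of the quadratic form of a solution. -/
theorem Solves.inner_im (hJ : IsSelfAdjoint J.operator) (h : J.Solves E x g) :
    (inner ℂ x g).im = -E.im * ‖x‖ ^ 2 := by
  have h1 := (solves_iff (J := J) (E := E) (g := g) ⟨x, h.mem_domain⟩).2 h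
  rw [← h1, inner_sub_right, inner_smul_right, Complex.sub_im,
    inner_operator_im hJ ⟨x, h.mem_domain⟩, inner_self_eq_norm_sq_to_K]
  have : ((‖x‖ : ℂ) ^ 2) = ((‖x‖ ^ 2 : ℝ) : ℂ) := by push_cast; rfl
  simp only [Complex.coe_algebraMap, this, Complex.im_mul_ofReal]
  ring

/-- Cauchy–Schwarz applied to `Solves.inner_im`. -/
theorem Solves.norm_le (hJ : IsSelfAdjoint J.operator) (h : J.Solves E x g) :
    |E.im| * ‖x‖ ≤ ‖g‖ := by
  rcases (norm_nonneg x).eq_or_lt with h0 | h0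
  · rw [← h0, mul_zero]; exact norm_nonneg _
  have h1 : |(inner ℂ x g).im| ≤ ‖x‖ * ‖g‖ :=
    (Complex.abs_im_le_norm _).trans (norm_inner_le_norm x g)
  rw [h.inner_im hJ, abs_mul, abs_neg, abs_of_nonneg (sq_nonneg ‖x‖)] at h1
  nlinarith

theorem Solves.sub (h : J.Solves E x g) {g' : SeqHilbert} (h' : J.Solves E y g') :
    J.Solves E (x - y) (g - g') := by
  rw [Solves] at h h' ⊢
  rw [lp.coeFn_sub, lp.coeFn_sub, sub_eq_add_neg (x : ℕ → ℂ), ← neg_one_smul ℂ (y : ℕ → ℂ),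
    action_add, action_smul, h, h']
  module

theorem mem_domain_of_finite {f : SeqHilbert} {N : ℕ} (h : ∀ n, N ≤ n → f n = 0) :
    f ∈ J.operator.domain :=
  memℓp_of_eventually_zero (J.action_eq_zero h)

/-- The map `(x, y) ↦ y - E x` on the graph of `J`. -/
noncomputable def graphMap (J : JacobiMatrix) (E : ℂ) : J.operator.graph →L[ℂ] SeqHilbert :=
  (ContinuousLinearMap.snd ℂ SeqHilbert SeqHilbert - E • ContinuousLinearMap.fst ℂ _ _).comp
    J.operator.graph.subtypeL

theorem solves_graph (p : J.operator.graph) : J.Solves E p.1.1 (J.graphMap E p) := by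
  obtain ⟨f, hf⟩ := (LinearPMap.mem_graph_iff' _).1 p.2
  have h1 : p.1.1 = (f : SeqHilbert) := by rw [← hf]
  have h2 : J.graphMap E p = J.operator f - E • (f : SeqHilbert) := by
    simp [graphMap, ← hf]
  rw [h1, h2, ← solves_iff]

/-- The graph of `J` is complete and `J - E` is bounded below on it, so its range is closed. A
vector orthogonal to the range lies in the domain of the adjoint, that is of `J`, and is an
eigenvector for the conjugate of `E`, hence zero. -/
theorem exists_solves (hJ : IsSelfAdjoint J.operator) (hE : E.im ≠ 0) (g : SeqHilbert) :
    ∃ x, J.Solves E x g := by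
  have hpos : 0 < |E.im| := abs_pos.2 hE
  have hcl : IsClosed (J.operator.graph : Set (SeqHilbert × SeqHilbert)) := hJ.isClosed
  have : CompleteSpace J.operator.graph := hcl.completeSpace_coe
  have hanti : ∃ K : NNReal, AntilipschitzWith K (J.graphMap E) := by
    refine ⟨⟨|E.im|⁻¹ + (1 + ‖E‖ * |E.im|⁻¹), by positivity⟩, ?_⟩
    refine AddMonoidHomClass.antilipschitz_of_bound _ fun p => ?_
    have h1 := (solves_graph (E := E) p).norm_le hJ
    have h2 : p.1.2 = J.graphMap E p + E • p.1.1 := by simp [graphMap]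
    have h3 : ‖p.1.1‖ ≤ |E.im|⁻¹ * ‖J.graphMap E p‖ := by
      rw [inv_mul_eq_div, le_div_iff₀ hpos]; linarith
    have h4 : ‖p.1.2‖ ≤ ‖J.graphMap E p‖ + ‖E‖ * (|E.im|⁻¹ * ‖J.graphMap E p‖) := by
      rw [h2]
      refine (norm_add_le _ _).trans ?_
      rw [norm_smul]
      gcongr
    have h5 : 0 ≤ ‖J.graphMap E p‖ := norm_nonneg _
    have h6 : 0 ≤ |E.im|⁻¹ * ‖J.graphMap E p‖ := by positivity
    have h7 : 0 ≤ ‖E‖ * (|E.im|⁻¹ * ‖J.graphMap E p‖) := by positivity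
    change ‖(p : SeqHilbert × SeqHilbert)‖ ≤ (|E.im|⁻¹ + (1 + ‖E‖ * |E.im|⁻¹)) * ‖J.graphMap E p‖
    rw [Prod.norm_def]
    refine max_le ?_ ?_ <;> nlinarith
  obtain ⟨K, hK⟩ := hanti
  have hrange : IsClosed (Set.range (J.graphMap E)) :=
    hK.isClosed_range (J.graphMap E).uniformContinuous
  set R : Submodule ℂ SeqHilbert := LinearMap.range (J.graphMap E).toLinearMap with hR
  have hRcl : IsClosed (R : Set SeqHilbert) := hrange
  have : CompleteSpace R := hRcl.completeSpace_coe
  have htop : R = ⊤ := by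
    rw [← Submodule.orthogonal_eq_bot_iff, Submodule.eq_bot_iff]
    intro y hy
    have horth : ∀ f : J.operator.domain,
        inner ℂ (starRingEnd ℂ E • y) (f : SeqHilbert) = inner ℂ y (J.operator f) := by
      intro f
      have := (Submodule.mem_orthogonal' R y).1 hy
        (J.graphMap E ⟨(f, J.operator f), J.operator.mem_graph f⟩) ⟨_, rfl⟩
      have h2 : J.graphMap E ⟨(f, J.operator f), J.operator.mem_graph f⟩ =
        J.operator f - E • (f : SeqHilbert) := by simp [graphMap]
      rw [h2, inner_sub_right, inner_smul_right, sub_eq_zero] at this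
      rw [inner_smul_left, this]
      simp
    have hmem : y ∈ (LinearPMap.adjoint J.operator).domain :=
      LinearPMap.mem_adjoint_domain_of_exists _ ⟨_, horth⟩
    have happ := LinearPMap.adjoint_apply_eq hJ.dense_domain ⟨y, hmem⟩ horth
    have hgr : (y, starRingEnd ℂ E • y) ∈ J.operator.graph := by
      have := LinearPMap.mem_graph (LinearPMap.adjoint J.operator) ⟨y, hmem⟩
      rw [happ] at this
      exact (LinearPMap.isSelfAdjoint_def.1 hJ) ▸ this
    have hs := solves_graph (E := starRingEnd ℂ E) ⟨_, hgr⟩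
    have h0 : J.graphMap (starRingEnd ℂ E) ⟨_, hgr⟩ = 0 := by simp [graphMap]
    rw [h0] at hs
    have := hs.norm_le hJ
    simp only [Complex.conj_im, abs_neg, norm_zero] at this
    have : ‖y‖ ≤ 0 := by nlinarith [norm_nonneg y]
    simpa using this
  have : g ∈ R := by rw [htop]; trivial
  obtain ⟨p, hp⟩ := this
  refine ⟨p.1.1, ?_⟩
  rw [← hp]
  exact solves_graph p

theorem mem_resolventSet_of_im_ne_zero (hJ : IsSelfAdjoint J.operator) (hE : E.im ≠ 0) :
    E ∈ J.resolventSet := by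
  rw [mem_resolventSet_iff]
  intro g
  obtain ⟨x, hx⟩ := exists_solves hJ hE g
  refine ⟨x, hx, fun y hy => ?_⟩
  have := (hy.sub hx).norm_le hJ
  rw [sub_self, norm_zero] at this
  have hpos : 0 < |E.im| := abs_pos.2 hE
  have h0 : ‖y - x‖ ≤ 0 := by nlinarith [norm_nonneg (y - x)]
  exact sub_eq_zero.1 (by simpa using h0)

theorem norm_deltaOne : ‖deltaOne‖ = 1 := by
  rw [deltaOne, lp.norm_single (by norm_num)]
  simp

theorem norm_m_le (hJ : IsSelfAdjoint J.operator) : |E.im| * ‖J.m E‖ ≤ 1 := by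
  by_cases hE : E.im = 0
  · simp [hE]
  obtain ⟨x, hx⟩ := exists_solves hJ hE deltaOne
  rw [m_eq (mem_resolventSet_of_im_ne_zero hJ hE) hx, ← norm_deltaOne]
  refine le_trans ?_ (hx.norm_le hJ)
  gcongr
  exact lp.norm_apply_le_norm (by norm_num) x 0

/-- The Herglotz property: `Im m(E) = Im E · ‖x‖²` for the resolvent vector `x`. -/
theorem m_im_nonpos (hJ : IsSelfAdjoint J.operator) (hE : E.im < 0) : (J.m E).im ≤ 0 := by
  obtain ⟨x, hx⟩ := exists_solves hJ hE.ne deltaOne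
  rw [m_eq (mem_resolventSet_of_im_ne_zero hJ hE.ne) hx]
  have h1 := hx.inner_im hJ
  rw [deltaOne, lp.inner_single_right] at h1
  simp only [RCLike.inner_apply, one_mul, Complex.conj_im] at h1
  nlinarith [sq_nonneg ‖x‖]

theorem m_conj (hJ : IsSelfAdjoint J.operator) (hE : E.im ≠ 0) :
    J.m (starRingEnd ℂ E) = starRingEnd ℂ (J.m E) := by
  obtain ⟨x, hx⟩ := exists_solves hJ hE deltaOne
  have hx' : J.Solves (starRingEnd ℂ E) (star x) deltaOne := by
    rw [Solves, lp.coeFn_star, action_conj, hx, star_add, star_smul]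
    congr 1
    funext n
    simp only [deltaOne, lp.coeFn_single, Pi.star_apply]
    rcases eq_or_ne n 0 with rfl | h <;> simp [*]
  rw [m_eq (mem_resolventSet_of_im_ne_zero hJ hE) hx,
    m_eq (mem_resolventSet_of_im_ne_zero hJ (by simpa using hE)) hx']
  rfl

/-- The iterates `Jᵏ δ₁`. -/
noncomputable def iterDelta (J : JacobiMatrix) (k : ℕ) : ℕ → ℂ := J.action^[k] (Pi.single 0 1)

theorem iterDelta_succ (J : JacobiMatrix) (k : ℕ) :
    J.iterDelta (k + 1) = J.action (J.iterDelta k) := by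
  rw [iterDelta, iterDelta, Function.iterate_succ_apply']

theorem iterDelta_eq_zero (J : JacobiMatrix) (k : ℕ) : ∀ n, k + 1 ≤ n → J.iterDelta k n = 0 := by
  induction k with
  | zero =>
    intro n hn
    rw [iterDelta, Function.iterate_zero, id, Pi.single_eq_of_ne (by omega)]
  | succ k ih =>
    rw [iterDelta_succ]
    exact J.action_eq_zero ih

theorem iterDelta_self (J : JacobiMatrix) (k : ℕ) :
    J.iterDelta k k = ((∏ j ∈ Finset.range k, J.a j : ℝ) : ℂ) := by
  induction k with
  | zero => simp [iterDelta]
  | succ k ih =>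
    rw [iterDelta_succ, action, ih, iterDelta_eq_zero J k _ le_rfl,
      iterDelta_eq_zero J k _ (by omega), Finset.prod_range_succ]
    push_cast
    ring

/-- `Jᵏ δ₁` as an element of `ℓ²`. -/
noncomputable def iterDeltaLp (J : JacobiMatrix) (k : ℕ) : SeqHilbert :=
  ⟨J.iterDelta k, memℓp_of_eventually_zero (J.iterDelta_eq_zero k)⟩

/-- If `(J - E) x = Jᵏ δ₁` then `Jᵏ δ₁ + E x` solves the next equation. -/
theorem Solves.step {k : ℕ} (h : J.Solves E x (J.iterDeltaLp k)) :
    J.Solves E (J.iterDeltaLp k + E • x) (J.iterDeltaLp (k + 1)) := by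
  have h' : J.action x = J.iterDelta k + E • (x : ℕ → ℂ) := h
  change J.action (J.iterDelta k + E • (x : ℕ → ℂ)) =
    J.iterDelta (k + 1) + E • (J.iterDelta k + E • (x : ℕ → ℂ))
  rw [action_add, action_smul, h', iterDelta_succ]

/-- Iterate `Solves.step`. As `Jᵏ δ₁` vanishes beyond index `k`, the entries from `k + 1` on are
merely multiplied by `E` at each step. -/
theorem exists_solves_iterDelta (hx : J.Solves E x deltaOne) (k : ℕ) :
    ∃ y, J.Solves E y (J.iterDeltaLp k) ∧ ∀ n, k ≤ n → y n = E ^ k * x n := by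
  induction k with
  | zero => exact ⟨x, hx, fun n _ => by simp⟩
  | succ k ih =>
    obtain ⟨y, hy, hy'⟩ := ih
    refine ⟨_, hy.step, fun n hn => ?_⟩
    change J.iterDelta k n + E * y n = _
    rw [iterDelta_eq_zero J k n hn, hy' n (by omega)]
    ring

/-- Decay of the components of the resolvent vector `(J - E)⁻¹ δ₁` away from the real axis. -/
theorem exists_resolvent_bound (hJ : IsSelfAdjoint J.operator) (n : ℕ) :
    ∃ C : ℝ, ∀ E x, J.Solves E x deltaOne →
      |E.im| * ‖E ^ (n + 1) * x n + ((∏ j ∈ Finset.range n, J.a j : ℝ) : ℂ)‖ ≤ C := by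
  refine ⟨‖J.iterDeltaLp (n + 1)‖, fun E x hx => ?_⟩
  obtain ⟨y, hy, hy'⟩ := exists_solves_iterDelta hx n
  have h1 := hy.step.norm_le hJ
  have h2 : (J.iterDeltaLp n + E • y) n =
      E ^ (n + 1) * x n + ((∏ j ∈ Finset.range n, J.a j : ℝ) : ℂ) := by
    change J.iterDelta n n + E * y n = _
    rw [iterDelta_self, hy' n le_rfl]
    ring
  rw [← h2]
  refine le_trans ?_ h1
  gcongr
  exact lp.norm_apply_le_norm (by norm_num) _ n

end JacobiMatrix

end

/-! ### Finite-rank perturbations, the three-term recurrence and the Jost solution. -/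

section

open Polynomial

namespace JacobiMatrix

variable {J : JacobiMatrix}

theorem action_sub_free_apply (f : ℕ → ℂ) (n : ℕ) :
    J.action f (n + 1) - free.action f (n + 1) = ((J.a n : ℂ) - 1) * f n +
      (J.b (n + 1) : ℂ) * f (n + 1) + ((J.a (n + 1) : ℂ) - 1) * f (n + 2) := by
  simp only [action, free]
  push_cast
  ring

/-- `J - J₀` has finite rank iff the parameters are eventually those of `J₀`. -/
theorem finiteRankPerturbation_iff :
    J.FiniteRankPerturbation ↔ ∃ N, ∀ n, N ≤ n → J.a n = 1 ∧ J.b n = 0 := by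
  have happ : ∀ (f : (J.operator - free.operator).domain) (n : ℕ),
      ((J.operator - free.operator).toFun f : SeqHilbert) n =
        J.action (f : SeqHilbert) n - free.action (f : SeqHilbert) n := fun f n => rfl
  constructor
  · intro h
    set V := LinearMap.range (J.operator - free.operator).toFun with hV
    have : FiniteDimensional ℂ V := h
    -- The subspaces of vectors supported below `N` form an ascending chain in the
    -- finite-dimensional range, so they stabilize. The image of every basis vector has finite
    -- support, and therefore support below one common `N`.
    let S : ℕ →o Submodule ℂ V :=
      { toFun := fun N =>
          { carrier := {v | ∀ n, N ≤ n → (v : SeqHilbert) n = 0}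
            add_mem' := fun {v w} hv hw n hn => by
              change (v : SeqHilbert) n + (w : SeqHilbert) n = 0
              rw [hv n hn, hw n hn, add_zero]
            zero_mem' := fun n _ => rfl
            smul_mem' := fun c v hv n hn => by
              change c * (v : SeqHilbert) n = 0
              rw [hv n hn, mul_zero] }
        monotone' := fun N M hNM v hv n hn => hv n (hNM.trans hn) }
    obtain ⟨N, hN⟩ := monotone_stabilizes_iff_noetherian.2 (inferInstance : IsNoetherian ℂ V) S
    have key : ∀ k n, N ≤ n →
        J.action (Pi.single k 1) n - free.action (Pi.single k 1) n = 0 := by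
      intro k n hn
      have hfin : ∀ n, k + 1 ≤ n → (lp.single 2 k (1 : ℂ) : SeqHilbert) n = 0 := fun n hn => by
        rw [lp.single_apply, Pi.single_eq_of_ne (by omega)]
      let f : (J.operator - free.operator).domain :=
        ⟨lp.single 2 k 1, mem_domain_of_finite hfin, mem_domain_of_finite hfin⟩
      let v : V := ⟨_, LinearMap.mem_range_self _ f⟩
      have hv : v ∈ S (max N (k + 2)) := by
        intro n hn
        have hn' : k + 2 ≤ n := (le_max_right _ _).trans hn
        change J.action (lp.single 2 k (1 : ℂ) : SeqHilbert) n -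
          free.action (lp.single 2 k (1 : ℂ) : SeqHilbert) n = 0
        rw [J.action_eq_zero hfin n hn', free.action_eq_zero hfin n hn', sub_zero]
      rw [← hN _ (le_max_left _ _)] at hv
      exact hv n hn
    refine ⟨N + 1, fun n hn => ?_⟩
    obtain ⟨k, rfl⟩ : ∃ k, n = k + 1 := ⟨n - 1, by omega⟩
    -- In the column of the basis vector with index `k + 1`, row `k + 2` is `a (k + 1) - 1` and row
    -- `k + 1` is `b (k + 1)`.
    have h1 := key (k + 1) (k + 2) (by omega)
    have h2 := key (k + 1) (k + 1) (by omega)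
    rw [action_sub_free_apply] at h1 h2
    simp only [Pi.single_apply, if_pos] at h1 h2
    simp at h1 h2
    exact ⟨by exact_mod_cast sub_eq_zero.1 h1, h2⟩
  · rintro ⟨N, hN⟩
    have hzero : ∀ v ∈ LinearMap.range (J.operator - free.operator).toFun,
        ∀ n, N + 1 ≤ n → (v : SeqHilbert) n = 0 := by
      rintro _ ⟨f, rfl⟩ n hn
      obtain ⟨k, rfl⟩ : ∃ k, n = k + 1 := ⟨n - 1, by omega⟩
      rw [happ, action_sub_free_apply, (hN k (by omega)).1, (hN (k + 1) (by omega)).1,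
        (hN (k + 1) (by omega)).2]
      simp
    let φ : LinearMap.range (J.operator - free.operator).toFun →ₗ[ℂ] (Fin (N + 1) → ℂ) :=
      { toFun := fun v i => (v : SeqHilbert) i
        map_add' := fun v w => rfl
        map_smul' := fun c v => rfl }
    refine FiniteDimensional.of_injective φ fun v w hvw => Subtype.ext (lp.ext (funext fun n => ?_))
    rcases lt_or_ge n (N + 1) with hn | hn
    · exact congrFun hvw ⟨n, hn⟩
    · rw [hzero v v.2 n hn, hzero w w.2 n hn]

/-- The off-diagonal entries with the convention `a₀ = 1`. -/
def offDiag (J : JacobiMatrix) : ℕ → ℝ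
  | 0 => 1
  | k + 1 => J.a k

theorem offDiag_pos (J : JacobiMatrix) (k : ℕ) : 0 < J.offDiag k := by
  cases k with
  | zero => exact one_pos
  | succ k => exact J.a_pos k

/-- The three-term recurrence `aₖ₊₁ yₖ₊₂ + bₖ₊₁ yₖ₊₁ + aₖ yₖ = E yₖ₊₁`. -/
def Recurrence (J : JacobiMatrix) (E : ℂ) (y : ℕ → ℂ) : Prop :=
  ∀ k, (J.a k : ℂ) * y (k + 2) + (J.b k : ℂ) * y (k + 1) + (J.offDiag k : ℂ) * y k = E * y (k + 1)

/-- Constancy of the Wronskian; the convention `offDiag 0 = 1` makes its initial value free of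
parameters. -/
theorem Recurrence.wronskian {E : ℂ} {y w : ℕ → ℂ} (hy : J.Recurrence E y)
    (hw : J.Recurrence E w) (k : ℕ) :
    (J.offDiag k : ℂ) * (y (k + 1) * w k - y k * w (k + 1)) = y 1 * w 0 - y 0 * w 1 := by
  induction k with
  | zero => simp [offDiag]
  | succ k ih =>
    rw [← ih, offDiag]
    linear_combination w (k + 1) * hy k - y (k + 1) * hw k

theorem Recurrence.eq_zero {E : ℂ} {y : ℕ → ℂ} (hy : J.Recurrence E y) (h0 : y 0 = 0)
    (h1 : y 1 = 0) (k : ℕ) : y k = 0 := by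
  suffices y k = 0 ∧ y (k + 1) = 0 from this.1
  induction k with
  | zero => exact ⟨h0, h1⟩
  | succ k ih =>
    refine ⟨ih.2, ?_⟩
    have h := hy k
    rw [ih.1, ih.2] at h
    have ha : (J.a k : ℂ) ≠ 0 := by exact_mod_cast (J.a_pos k).ne'
    simpa [ha] using h

theorem Recurrence.action_eq {E : ℂ} {y : ℕ → ℂ} (hy : J.Recurrence E y) :
    J.action (fun k => y (k + 1)) = E • (fun k => y (k + 1)) - y 0 • Pi.single 0 1 := by
  funext n
  cases n with
  | zero =>
    have h := hy 0
    simp only [offDiag, Complex.ofReal_one] at h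
    simp only [action, Pi.sub_apply, Pi.smul_apply, Pi.single_eq_same, smul_eq_mul]
    linear_combination h
  | succ n =>
    have h := hy (n + 1)
    simp only [offDiag] at h
    simp only [action, Pi.sub_apply, Pi.smul_apply, smul_eq_mul,
      Pi.single_eq_of_ne (Nat.succ_ne_zero n)]
    linear_combination h

/-- The sequence `1, -x₁, -x₂, …` attached to a resolvent vector `x`. -/
def resolventSeq (x : ℕ → ℂ) : ℕ → ℂ
  | 0 => 1
  | k + 1 => -x k

theorem Solves.recurrence {E : ℂ} {x : SeqHilbert} (h : J.Solves E x deltaOne) :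
    J.Recurrence E (resolventSeq x) := by
  intro k
  have h' := congrFun h k
  cases k with
  | zero =>
    have hd : (deltaOne : ℕ → ℂ) 0 = 1 := by simp [deltaOne]
    simp only [action, Pi.add_apply, Pi.smul_apply, smul_eq_mul, hd] at h'
    simp only [offDiag, Complex.ofReal_one, resolventSeq]
    linear_combination -h'
  | succ k =>
    have hd : (deltaOne : ℕ → ℂ) (k + 1) = 0 := by simp [deltaOne]
    simp only [action, Pi.add_apply, Pi.smul_apply, smul_eq_mul, hd] at h'
    simp only [offDiag, resolventSeq]
    linear_combination -h'

/-- A decaying solution of the recurrence determines the `m`-function. -/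
theorem Recurrence.m_eq {E : ℂ} {y : ℕ → ℂ} (hy : J.Recurrence E y)
    (hmem : Memℓp (fun k => y (k + 1)) 2) (hne : ∃ k, y k ≠ 0) (hE : E ∈ J.resolventSet) :
    y 0 ≠ 0 ∧ -J.m E = y 1 / y 0 := by
  let x : SeqHilbert := ⟨_, hmem⟩
  have hx : (x : ℕ → ℂ) = fun k => y (k + 1) := rfl
  have h0 : y 0 ≠ 0 := by
    intro h0
    -- With `y 0 = 0` the shifted sequence would be an eigenvector at a point of the resolvent set.
    have hs : J.Solves E x 0 := by
      rw [Solves, hx, hy.action_eq, h0, zero_smul, sub_zero, lp.coeFn_zero, zero_add]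
    have hs0 : J.Solves E 0 0 := by
      rw [Solves, lp.coeFn_zero, smul_zero, add_zero]
      simpa using J.action_smul 0 0
    have hx0 : x = 0 := (mem_resolventSet_iff.1 hE 0).unique hs hs0
    obtain ⟨k, hk⟩ := hne
    cases k with
    | zero => exact hk h0
    | succ k => exact hk (by simpa [hx] using congrArg (fun v : SeqHilbert => v k) hx0)
  refine ⟨h0, ?_⟩
  have hs : J.Solves E ((-(y 0)⁻¹) • x) deltaOne := by
    rw [Solves, lp.coeFn_smul, action_smul, hx, hy.action_eq, deltaOne, lp.coeFn_single,
      smul_sub, smul_smul (-(y 0)⁻¹) (y 0), neg_mul, inv_mul_cancel₀ h0]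
    module
  rw [JacobiMatrix.m_eq hE hs]
  change -(-(y 0)⁻¹ * y 1) = _
  ring

/-- The polynomials `z⁻ᵏ yₖ(z)`, for the solution equal to `zᵏ` for large `k`. -/
theorem exists_jost_polynomials {N : ℕ} (hN : ∀ n, N ≤ n → J.a n = 1 ∧ J.b n = 0) :
    ∃ P : ℕ → ℝ[X], (∀ k, N + 1 ≤ k → P k = 1) ∧ ∀ k, C (J.offDiag k) * P k =
      (X ^ 2 + 1 - C (J.b k) * X) * P (k + 1) - C (J.a k) * X ^ 2 * P (k + 2) := by
  -- Backward recursion: each step in `j` defines one more `P`, by solving the recurrence for its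
  -- lowest term. It starts at `N + 1` because the relation at `k` involves `offDiag k`, which is `a
  -- (k - 1)`.
  suffices h : ∀ j ≤ N + 1, ∃ P : ℕ → ℝ[X], (∀ k, N + 1 ≤ k → P k = 1) ∧
      ∀ k, N + 1 - j ≤ k → C (J.offDiag k) * P k =
        (X ^ 2 + 1 - C (J.b k) * X) * P (k + 1) - C (J.a k) * X ^ 2 * P (k + 2) by
    obtain ⟨P, h1, h2⟩ := h (N + 1) le_rfl
    exact ⟨P, h1, fun k => h2 k (by omega)⟩
  intro j
  induction j with
  | zero =>
    refine fun _ => ⟨fun _ => 1, fun _ _ => rfl, fun k hk => ?_⟩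
    obtain ⟨l, rfl⟩ : ∃ l, k = l + 1 := ⟨k - 1, by omega⟩
    rw [offDiag, (hN l (by omega)).1, (hN (l + 1) (by omega)).1, (hN (l + 1) (by omega)).2]
    simp
  | succ j ih =>
    intro hj
    obtain ⟨P, h1, h2⟩ := ih (by omega)
    set i := N + 1 - (j + 1) with hi
    refine ⟨Function.update P i (C (J.offDiag i)⁻¹ *
      ((X ^ 2 + 1 - C (J.b i) * X) * P (i + 1) - C (J.a i) * X ^ 2 * P (i + 2))),
      fun k hk => ?_, fun k hk => ?_⟩
    · rw [Function.update_of_ne (by omega), h1 k hk]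
    · rcases hk.eq_or_lt with rfl | hlt
      · rw [Function.update_self, Function.update_of_ne (by omega), Function.update_of_ne (by omega),
          ← mul_assoc, ← C_mul, mul_inv_cancel₀ (J.offDiag_pos i).ne', C_1, one_mul]
      · rw [Function.update_of_ne (by omega), Function.update_of_ne (by omega),
          Function.update_of_ne (by omega), h2 k (by omega)]

/-- The Jost solution at index `0` and `1` for a finite-rank perturbation. -/
theorem exists_jost_pair {N : ℕ} (hN : ∀ n, N ≤ n → J.a n = 1 ∧ J.b n = 0) :
    ∃ U V : ℝ[X], 0 < U.eval 0 ∧ (∀ z : ℂ, ¬ (aeval z U = 0 ∧ aeval z V = 0)) ∧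
      (∀ z : ℂ, z ≠ 0 → aeval z V * aeval z⁻¹ U - aeval z U * aeval z⁻¹ V = z - z⁻¹) ∧
      ∀ z : ℂ, ‖z‖ < 1 → z ≠ 0 → z + z⁻¹ ∈ J.resolventSet →
        aeval z U ≠ 0 ∧ J.M z = aeval z V / aeval z U := by
  obtain ⟨P, hP1, hP⟩ := exists_jost_polynomials hN
  have hrec : ∀ z : ℂ, z ≠ 0 → J.Recurrence (z + z⁻¹) fun k => z ^ k * aeval z (P k) := by
    intro z hz k
    have h := congrArg (aeval z) (hP k)
    simp only [map_mul, map_sub, map_add, map_pow, aeval_X, aeval_C, map_one,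
      Complex.coe_algebraMap] at h
    have hzz : z * z⁻¹ = 1 := mul_inv_cancel₀ hz
    linear_combination z ^ k * h - z ^ k * aeval z (P (k + 1)) * hzz
  -- At `z = 0` the relation collapses to `offDiag k · Pₖ(0) = Pₖ₊₁(0)`, so positivity propagates
  -- downwards.
  have hpos : ∀ j k, N + 1 ≤ k + j → 0 < (P k).eval 0 := by
    intro j
    induction j with
    | zero => intro k hk; rw [hP1 k (by omega)]; simp
    | succ j ih =>
      intro k hk
      have h := congrArg (eval 0) (hP k)
      simp only [eval_mul, eval_sub, eval_add, eval_pow, eval_X, eval_C, eval_one] at h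
      have h1 := ih (k + 1) (by omega)
      have h2 := J.offDiag_pos k
      have h3 : J.offDiag k * (P k).eval 0 = (P (k + 1)).eval 0 := by rw [h]; ring
      exact (pos_iff_pos_of_mul_pos (h3 ▸ h1)).1 h2
  have hbig : ∀ z : ℂ, z ^ (N + 1) * aeval z (P (N + 1)) = z ^ (N + 1) := fun z => by
    rw [hP1 _ le_rfl, map_one, mul_one]
  have hU0 : 0 < (P 0).eval 0 := hpos (N + 1) 0 (by omega)
  refine ⟨P 0, X * P 1, hU0, ?_, ?_, ?_⟩
  · rintro z ⟨h0, h1⟩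
    rcases eq_or_ne z 0 with rfl | hz
    · rw [aeval_def, eval₂_at_zero, coeff_zero_eq_eval_zero] at h0
      simp at h0
      exact hU0.ne' h0
    · have := (hrec z hz).eq_zero (by simpa using h0) (by simpa using h1) (N + 1)
      change z ^ (N + 1) * aeval z (P (N + 1)) = 0 at this
      rw [hbig] at this
      exact pow_ne_zero _ hz this
  · intro z hz
    have hz' : z⁻¹ ≠ 0 := inv_ne_zero hz
    have h2 := hrec z⁻¹ hz'
    rw [inv_inv, add_comm] at h2
    -- At index `N + 1` the two solutions are exactly the powers of `z` and of `z⁻¹`.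
    have := (hrec z hz).wronskian h2 (N + 1)
    simp only [offDiag, (hN N le_rfl).1, hP1 (N + 1) le_rfl, hP1 (N + 1 + 1) (by omega), map_one,
      mul_one, Complex.ofReal_one, one_mul, pow_zero, pow_one] at this
    simp only [map_mul, aeval_X]
    rw [← this, pow_succ, pow_succ (z⁻¹)]
    have : z ^ (N + 1) * z⁻¹ ^ (N + 1) = 1 := by rw [← mul_pow, mul_inv_cancel₀ hz, one_pow]
    rw [pow_succ, pow_succ] at this
    linear_combination (z - z⁻¹) * this
  · intro z hz hz0 hE
    have hmem : Memℓp (fun k => z ^ (k + 1) * aeval z (P (k + 1))) 2 := by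
      refine memℓp_gen ?_
      have hs : Summable fun k : ℕ => (‖z‖ ^ 2) ^ (k + 1) :=
        (summable_nat_add_iff 1).2 (summable_geometric_of_lt_one (by positivity)
          (by nlinarith [norm_nonneg z]))
      refine (summable_congr_cofinite ?_).2 hs
      rw [Nat.cofinite_eq_atTop]
      filter_upwards [Filter.eventually_ge_atTop N] with k hk
      rw [hP1 (k + 1) (by omega), map_one, mul_one, norm_pow]
      simp only [ENNReal.toReal_ofNat, Real.rpow_ofNat]
      ring
    have h := (hrec z hz0).m_eq hmem ⟨N + 1, by
      rw [hbig]
      exact pow_ne_zero _ hz0⟩ hE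
    simpa [M] using h

end JacobiMatrix

end

/-! ### From finite rank to a rational `M`-function with canonical weights. -/

section

open Polynomial Filter

theorem RatFunc.eval_eq_div (r : RatFunc ℂ) (z : ℂ) :
    r.eval (RingHom.id ℂ) z = r.num.eval z / r.denom.eval z := by
  rw [RatFunc.eval, eval₂_id, eval₂_id]

section Quotient

variable {U V : ℂ[X]}

/-- Without common zeros the fraction is already reduced, so `U` differs from the normalized
denominator by a unit only. -/
theorem denom_dvd_and_dvd (hU : U ≠ 0) (h : ∀ z, ¬ (U.eval z = 0 ∧ V.eval z = 0)) :
    (algebraMap ℂ[X] (RatFunc ℂ) V / algebraMap ℂ[X] (RatFunc ℂ) U).denom ∣ U ∧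
      U ∣ (algebraMap ℂ[X] (RatFunc ℂ) V / algebraMap ℂ[X] (RatFunc ℂ) U).denom := by
  refine ⟨RatFunc.denom_div_dvd _ _, ?_⟩
  have hcop : IsCoprime U V := by
    rw [Polynomial.isCoprime_iff_aeval_ne_zero_of_isAlgClosed ℂ ℂ]
    intro z
    have := h z
    rw [not_and_or] at this
    simpa using this
  have hrel := RatFunc.num_div_denom
    (algebraMap ℂ[X] (RatFunc ℂ) V / algebraMap ℂ[X] (RatFunc ℂ) U)
  set r := algebraMap ℂ[X] (RatFunc ℂ) V / algebraMap ℂ[X] (RatFunc ℂ) U with hr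
  rw [hr, div_eq_div_iff (by simpa using r.denom_ne_zero) (by simpa using hU), ← map_mul,
    ← map_mul] at hrel
  have hrel' := RatFunc.algebraMap_injective ℂ hrel
  exact hcop.dvd_of_dvd_mul_left ⟨r.num, by rw [← hrel', mul_comm]⟩

theorem eval_algebraMap_div (hU : U ≠ 0) (h : ∀ z, ¬ (U.eval z = 0 ∧ V.eval z = 0)) (z : ℂ) :
    (algebraMap ℂ[X] (RatFunc ℂ) V / algebraMap ℂ[X] (RatFunc ℂ) U).eval (RingHom.id ℂ) z =
      V.eval z / U.eval z := by
  obtain ⟨h1, h2⟩ := denom_dvd_and_dvd hU h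
  have hrel := RatFunc.num_div_denom
    (algebraMap ℂ[X] (RatFunc ℂ) V / algebraMap ℂ[X] (RatFunc ℂ) U)
  rw [RatFunc.eval_eq_div]
  set r := algebraMap ℂ[X] (RatFunc ℂ) V / algebraMap ℂ[X] (RatFunc ℂ) U with hr
  by_cases hz : U.eval z = 0
  · have : r.denom.eval z = 0 := eval_eq_zero_of_dvd_of_eval_eq_zero h2 hz
    rw [this, hz, div_zero, div_zero]
  · have hd : r.denom.eval z ≠ 0 := fun h0 => hz (eval_eq_zero_of_dvd_of_eval_eq_zero h1 h0)
    rw [hr, div_eq_div_iff (by simpa using r.denom_ne_zero) (by simpa using hU), ← map_mul,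
      ← map_mul] at hrel
    have hrel' := congrArg (eval z) (RatFunc.algebraMap_injective ℂ hrel)
    simp only [eval_mul] at hrel'
    rw [div_eq_div_iff hd hz, hrel']

theorem isPole_algebraMap_div (hU : U ≠ 0) (h : ∀ z, ¬ (U.eval z = 0 ∧ V.eval z = 0)) (z : ℂ) :
    IsPole (algebraMap ℂ[X] (RatFunc ℂ) V / algebraMap ℂ[X] (RatFunc ℂ) U) z ↔ U.eval z = 0 := by
  obtain ⟨h1, h2⟩ := denom_dvd_and_dvd hU h
  exact ⟨eval_eq_zero_of_dvd_of_eval_eq_zero h1, eval_eq_zero_of_dvd_of_eval_eq_zero h2⟩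

end Quotient

theorem rootMultiplicity_eq_one_iff {p : ℂ[X]} (hp : p ≠ 0) {z : ℂ} (hz : p.eval z = 0) :
    p.rootMultiplicity z = 1 ↔ p.derivative.eval z ≠ 0 := by
  have h1 : 0 < p.rootMultiplicity z := (rootMultiplicity_pos hp).2 hz
  have h2 := one_lt_rootMultiplicity_iff_isRoot (t := z) hp
  constructor
  · intro h h0
    have := h2.2 ⟨hz, h0⟩
    omega
  · intro h
    have : ¬ 1 < p.rootMultiplicity z := fun h' => h (h2.1 h').2
    omega

theorem exists_eq_sq_mul {p : ℂ[X]} {z : ℂ} (hz : p.eval z = 0) (hz' : p.derivative.eval z = 0) :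
    ∃ q : ℂ[X], p = (X - C z) ^ 2 * q := by
  rcases eq_or_ne p 0 with rfl | hp
  · exact ⟨0, by simp⟩
  · exact (le_rootMultiplicity_iff hp).1 ((one_lt_rootMultiplicity_iff_isRoot hp).2 ⟨hz, hz'⟩)

theorem inv_eq_conj_of_norm_eq_one {z : ℂ} (hz : ‖z‖ = 1) : z⁻¹ = starRingEnd ℂ z := by
  rw [Complex.inv_def, Complex.normSq_eq_norm_sq, hz]
  simp

theorem im_add_inv (z : ℂ) : (z + z⁻¹).im = z.im * (1 - (Complex.normSq z)⁻¹) := by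
  rw [Complex.add_im, Complex.inv_im]
  ring

theorem im_add_inv_eq_neg {z : ℂ} (hz : ‖z‖ < 1) (hz0 : z ≠ 0) :
    ∃ c : ℝ, 0 < c ∧ (z + z⁻¹).im = -c * z.im := by
  refine ⟨(Complex.normSq z)⁻¹ - 1, ?_, by rw [im_add_inv]; ring⟩
  have h1 : 0 < Complex.normSq z := Complex.normSq_pos.2 hz0
  have h2 : Complex.normSq z < 1 := by
    rw [Complex.normSq_eq_norm_sq]; nlinarith [norm_nonneg z]
  linarith [(one_lt_inv₀ h1).2 h2]

section Jost

variable {U V : ℂ[X]}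

theorem tendsto_sub_mul_div {z₀ : ℂ} (h0 : U.eval z₀ = 0) (h1 : U.derivative.eval z₀ ≠ 0) :
    Tendsto (fun z => (z - z₀) * (V.eval z / U.eval z)) (𝓝[≠] z₀)
      (𝓝 (V.eval z₀ / U.derivative.eval z₀)) := by
  have hs := hasDerivAt_iff_tendsto_slope.1 (U.hasDerivAt z₀)
  have hV : Tendsto (fun z => V.eval z) (𝓝[≠] z₀) (𝓝 (V.eval z₀)) :=
    (V.continuous.tendsto z₀).mono_left nhdsWithin_le_nhds
  refine (hV.div hs h1).congr' ?_
  filter_upwards [self_mem_nhdsWithin] with z hz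
  have : z - z₀ ≠ 0 := sub_ne_zero.2 hz
  simp only [slope, vsub_eq_sub, h0, sub_zero, smul_eq_mul, Pi.div_apply]
  field_simp

/-- The derivative of the Wronskian relation rules out double zeros at `±1`. -/
theorem derivative_ne_zero_of_wronskian
    (hW : ∀ z : ℂ, z ≠ 0 → V.eval z * U.eval z⁻¹ - U.eval z * V.eval z⁻¹ = z - z⁻¹)
    {z₀ : ℂ} (hz₀ : z₀ * z₀ = 1) (h0 : U.eval z₀ = 0) : U.derivative.eval z₀ ≠ 0 := by
  intro h1
  obtain ⟨H, rfl⟩ := exists_eq_sq_mul h0 h1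
  have hne : z₀ ≠ 0 := by rintro rfl; simp at hz₀
  have hinv : z₀⁻¹ = z₀ := inv_eq_of_mul_eq_one_left hz₀
  -- The Wronskian relation divided by `z - z₀`: a double zero of `U` sends the left side to `0`,
  -- while the right side is `(z + z₀) z⁻¹` and tends to `2`.
  have hlim : Tendsto (fun z : ℂ => (z - z₀) * (V.eval z * (z⁻¹ ^ 2 * H.eval z⁻¹) -
      H.eval z * V.eval z⁻¹)) (𝓝[≠] z₀) (𝓝 ((z₀ - z₀) * (V.eval z₀ * (z₀⁻¹ ^ 2 * H.eval z₀⁻¹) -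
      H.eval z₀ * V.eval z₀⁻¹))) := by
    refine Tendsto.mono_left (ContinuousAt.tendsto ?_) nhdsWithin_le_nhds
    have hi : ContinuousAt (fun z : ℂ => z⁻¹) z₀ := continuousAt_inv₀ hne
    have e1 : ContinuousAt (fun z : ℂ => H.eval z⁻¹) z₀ :=
      ContinuousAt.comp (f := fun z : ℂ => z⁻¹) (H.continuous.continuousAt) hi
    have e2 : ContinuousAt (fun z : ℂ => V.eval z⁻¹) z₀ :=
      ContinuousAt.comp (f := fun z : ℂ => z⁻¹) (V.continuous.continuousAt) hi
    exact (continuousAt_id.sub continuousAt_const).mul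
      ((V.continuous.continuousAt.mul ((hi.pow 2).mul e1)).sub (H.continuous.continuousAt.mul e2))
  have hlim2 : Tendsto (fun z : ℂ => (z + z₀) * z⁻¹) (𝓝[≠] z₀) (𝓝 ((z₀ + z₀) * z₀⁻¹)) :=
    Tendsto.mono_left (ContinuousAt.tendsto
      ((continuousAt_id.add continuousAt_const).mul (continuousAt_inv₀ hne))) nhdsWithin_le_nhds
  have heq := tendsto_nhds_unique (hlim.congr' ?_) hlim2
  · rw [sub_self, zero_mul, ← two_mul, mul_assoc, mul_inv_cancel₀ hne] at heq
    norm_num at heq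
  · filter_upwards [self_mem_nhdsWithin, nhdsWithin_le_nhds (isOpen_ne.mem_nhds hne)] with z hz hz'
    have hsub : z - z₀ ≠ 0 := sub_ne_zero.2 hz
    have hz1 : z * z⁻¹ = 1 := mul_inv_cancel₀ hz'
    have h := hW z hz'
    simp only [eval_mul, eval_pow, eval_sub, eval_X, eval_C] at h
    have e1 : (z⁻¹ - z₀) ^ 2 = z⁻¹ ^ 2 * (z - z₀) ^ 2 := by
      linear_combination (z⁻¹ ^ 2 * z ^ 2 - 1 - (z⁻¹ ^ 2 * z ^ 2 - 1)) * hz1 +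
        (1 - z⁻¹ ^ 2) * hz₀ + (2 * z₀ * z⁻¹ - z⁻¹ * z - 1) * hz1
    have e2 : z - z⁻¹ = (z - z₀) * ((z + z₀) * z⁻¹) := by
      linear_combination -z * hz1 + z⁻¹ * hz₀
    rw [e1, e2] at h
    apply mul_left_cancel₀ hsub
    rw [← h]
    ring

theorem one_sub_conj_mul_ne_zero {w z : ℂ} (hw : ‖w‖ < 1) (hz : ‖z‖ < 1) :
    1 - starRingEnd ℂ w * z ≠ 0 := by
  intro h
  have h2 : ‖starRingEnd ℂ w * z‖ = 1 := by rw [← sub_eq_zero.1 h, norm_one]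
  rw [norm_mul, RCLike.norm_conj] at h2
  nlinarith [norm_nonneg w, norm_nonneg z]

theorem prod_blaschke_mul {S : Finset ℂ} (hS : (0 : ℂ) ∉ S) (hS1 : ∀ w ∈ S, ‖w‖ < 1) {z : ℂ}
    (hz : ‖z‖ < 1) :
    (∏ w ∈ S, blaschkeFactor z w) * ∏ w ∈ S, (1 - starRingEnd ℂ w * z) =
      ∏ w ∈ S, ((‖w‖ : ℂ) / w * (w - z)) := by
  rw [← Finset.prod_mul_distrib]
  refine Finset.prod_congr rfl fun w hw => ?_
  have hw0 : w ≠ 0 := fun h => hS (h ▸ hw)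
  rw [blaschkeFactor, if_neg hw0]
  rw [mul_assoc, div_mul_cancel₀ _ (one_sub_conj_mul_ne_zero (hS1 w hw) hz)]

/-- A polynomial positive at `0` with simple zeros in the disk is a Blaschke product times the
exponential of the Herglotz integral of its logarithmic modulus. -/
theorem blaschke_mul_exp_herglotzIntegral (hU : U ≠ 0) (hU0 : U.eval 0 = ‖U.eval 0‖)
    (hU0' : U.eval 0 ≠ 0) {S : Finset ℂ} (hS : ∀ w, w ∈ S ↔ ‖w‖ < 1 ∧ U.eval w = 0)
    (hsimple : ∀ w ∈ S, U.derivative.eval w ≠ 0) {z : ℂ} (hz : ‖z‖ < 1) :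
    (∏ w ∈ S, blaschkeFactor z w) *
      Complex.exp (herglotzIntegral (fun ζ => Real.log ‖U.eval ζ‖) z) = U.eval z := by
  have h0S : (0 : ℂ) ∉ S := fun h => hU0' ((hS 0).1 h).2
  obtain ⟨p, hp⟩ : (∏ w ∈ S, (X - C w)) ∣ U := by
    change (S.val.map fun w => X - C w).prod ∣ U
    rw [Multiset.prod_X_sub_C_dvd_iff_le_roots hU, Multiset.le_iff_subset S.nodup]
    intro w hw
    exact (mem_roots hU).2 ((hS w).1 hw).2
  have hpz : ∀ x, ‖x‖ < 1 → p.eval x ≠ 0 := by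
    intro x hx h
    have hxS : x ∈ S := (hS x).2 ⟨hx, by rw [hp, eval_mul, h, mul_zero]⟩
    refine hsimple x hxS ?_
    obtain ⟨q, hq⟩ : (X - C x) ∣ ∏ w ∈ S, (X - C w) := Finset.dvd_prod_of_mem _ hxS
    rw [hp, derivative_mul, eval_add, eval_mul, eval_mul, h, hq]
    simp
  -- Reflecting the disk zeros across the circle keeps the modulus there and leaves no zero inside.
  set q : ℂ[X] := (∏ w ∈ S, (1 - C (starRingEnd ℂ w) * X)) * p with hq
  have hqz : ∀ x, ‖x‖ < 1 → q.eval x ≠ 0 := by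
    intro x hx
    rw [hq, eval_mul, eval_prod]
    refine mul_ne_zero (Finset.prod_ne_zero_iff.2 fun w hw => ?_) (hpz x hx)
    simpa using one_sub_conj_mul_ne_zero ((hS w).1 hw).1 hx
  have hnorm : ∀ ζ : ℂ, ‖ζ‖ = 1 → ‖U.eval ζ‖ = ‖q.eval ζ‖ := by
    intro ζ hζ
    rw [hp, hq, eval_mul, eval_mul, norm_mul, norm_mul, eval_prod, eval_prod, norm_prod, norm_prod]
    congr 1
    refine Finset.prod_congr rfl fun w _ => ?_
    simp [norm_one_sub_conj_mul hζ]
  rw [herglotzIntegral_congr (S := ∅) Set.finite_empty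
    (h := fun ζ => Real.log ‖q.eval ζ‖) (fun ζ hζ _ => by rw [hnorm ζ hζ]),
    exp_herglotzIntegral_log_norm_eval hqz hz]
  have hb := prod_blaschke_mul h0S (fun w hw => ((hS w).1 hw).1) hz
  have hqe : q.eval z = (∏ w ∈ S, (1 - starRingEnd ℂ w * z)) * p.eval z := by
    rw [hq, eval_mul, eval_prod]; simp
  have hq0 : q.eval 0 = p.eval 0 := by rw [hq, eval_mul, eval_prod]; simp
  have hp0 : p.eval 0 ≠ 0 := hpz 0 (by simp)
  have hUe : ∀ x, U.eval x = (∏ w ∈ S, (x - w)) * p.eval x := by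
    intro x; rw [hp, eval_mul, eval_prod]; simp
  have hA : ∏ w ∈ S, ((‖w‖ : ℂ) / w * (w - z)) =
      (∏ w ∈ S, ((‖w‖ : ℂ) / (0 - w))) * ∏ w ∈ S, (z - w) := by
    rw [← Finset.prod_mul_distrib]
    refine Finset.prod_congr rfl fun w hw => ?_
    have hw0 : w ≠ 0 := fun h => h0S (h ▸ hw)
    rw [zero_sub]
    field_simp
    ring
  -- The unimodular constants of the Blaschke factors and of the outer part cancel because `U(0) >
  -- 0`.
  have hphase : (∏ w ∈ S, ((‖w‖ : ℂ) / (0 - w))) * (‖p.eval 0‖ / p.eval 0) = 1 := by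
    rw [Finset.prod_div_distrib, div_mul_div_comm, ← hUe 0]
    rw [div_eq_one_iff_eq hU0', hU0, hUe 0, norm_mul, norm_prod]
    simp
  rw [hqe, hq0, hUe z]
  linear_combination (‖p.eval 0‖ / p.eval 0) * p.eval z * (hb + hA) +
    (∏ w ∈ S, (z - w)) * p.eval z * hphase

/-- On the circle `ζ⁻¹` is the conjugate of `ζ`, so the Wronskian is `2i` times the imaginary part
of `V` times the conjugate of `U`. -/
theorem im_div_of_wronskian (hUc : ∀ z, U.eval (starRingEnd ℂ z) = starRingEnd ℂ (U.eval z))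
    (hVc : ∀ z, V.eval (starRingEnd ℂ z) = starRingEnd ℂ (V.eval z))
    (hW : ∀ z : ℂ, z ≠ 0 → V.eval z * U.eval z⁻¹ - U.eval z * V.eval z⁻¹ = z - z⁻¹)
    {ζ : ℂ} (hζ : ‖ζ‖ = 1) : (V.eval ζ / U.eval ζ).im = ζ.im / ‖U.eval ζ‖ ^ 2 := by
  have h := hW ζ (by rintro rfl; simp at hζ)
  rw [inv_eq_conj_of_norm_eq_one hζ, hUc, hVc] at h
  have h2 := congrArg Complex.im h
  simp only [Complex.sub_im, Complex.mul_im, Complex.conj_re, Complex.conj_im] at h2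
  rw [Complex.div_im, ← Complex.normSq_eq_norm_sq, ← sub_div]
  congr 1
  linarith

end Jost

namespace JacobiMatrix

variable {J : JacobiMatrix}

theorem norm_div_le_of_eq_m {U V : ℂ[X]} (hJ : IsSelfAdjoint J.operator)
    (hM : ∀ z : ℂ, ‖z‖ < 1 → z ≠ 0 → z + z⁻¹ ∈ J.resolventSet →
      U.eval z ≠ 0 ∧ J.M z = V.eval z / U.eval z)
    {z : ℂ} (hz : ‖z‖ < 1) (him : z.im ≠ 0) :
    |(z + z⁻¹).im| * ‖V.eval z‖ ≤ ‖U.eval z‖ := by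
  have hz0 : z ≠ 0 := by rintro rfl; simp at him
  obtain ⟨c, hc, hc'⟩ := im_add_inv_eq_neg hz hz0
  have hE : (z + z⁻¹).im ≠ 0 := by
    rw [hc']; exact mul_ne_zero (by linarith) him
  obtain ⟨h1, h2⟩ := hM z hz hz0 (mem_resolventSet_of_im_ne_zero hJ hE)
  have h3 := norm_m_le hJ (E := z + z⁻¹)
  have h4 : ‖J.m (z + z⁻¹)‖ = ‖V.eval z‖ / ‖U.eval z‖ := by
    rw [← norm_div, ← h2, M, norm_neg]
  rw [h4, ← mul_div_assoc, div_le_one (norm_pos_iff.2 h1)] at h3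
  exact h3

/-- The poles in the open disk of a function bounded by `1 / |Im (z + z⁻¹)|` are simple. -/
theorem derivative_ne_zero_of_real {U V : ℂ[X]}
    (hbound : ∀ z : ℂ, ‖z‖ < 1 → z.im ≠ 0 → |(z + z⁻¹).im| * ‖V.eval z‖ ≤ ‖U.eval z‖)
    {z₀ : ℂ} (hz : ‖z₀‖ < 1) (hz0 : z₀ ≠ 0) (him : z₀.im = 0) (hU : U.eval z₀ = 0)
    (hV : V.eval z₀ ≠ 0) : U.derivative.eval z₀ ≠ 0 := by
  intro hU'
  obtain ⟨H, rfl⟩ := exists_eq_sq_mul hU hU'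
  -- Approach `z₀` vertically: `|Im (z + z⁻¹)|` is comparable to `t`, whereas a double zero makes
  -- `U` of order `t²`.
  set γ : ℝ → ℂ := fun t => z₀ + t * Complex.I with hγ
  have hγc : Continuous γ := by fun_prop
  have hγ0 : γ 0 = z₀ := by simp [hγ]
  have hlim1 : Tendsto (fun t : ℝ => |1 - (Complex.normSq (γ t))⁻¹| * ‖V.eval (γ t)‖) (𝓝[>] 0)
      (𝓝 (|1 - (Complex.normSq z₀)⁻¹| * ‖V.eval z₀‖)) := by
    rw [← hγ0]
    refine Tendsto.mono_left (ContinuousAt.tendsto (f := fun t : ℝ =>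
      |1 - (Complex.normSq (γ t))⁻¹| * ‖V.eval (γ t)‖) ?_) nhdsWithin_le_nhds
    refine ContinuousAt.mul ?_ (V.continuous.comp hγc).norm.continuousAt
    refine (continuousAt_const.sub (ContinuousAt.inv₀
      (Complex.continuous_normSq.comp hγc).continuousAt ?_)).abs
    simpa [hγ0] using hz0
  have hlim2 : Tendsto (fun t : ℝ => t * ‖H.eval (γ t)‖) (𝓝[>] 0) (𝓝 (0 * ‖H.eval (γ 0)‖)) :=
    Tendsto.mono_left ((continuous_id.mul (H.continuous.comp hγc).norm).tendsto 0)
      nhdsWithin_le_nhds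
  have hball : ∀ᶠ t in 𝓝[>] (0 : ℝ), ‖γ t‖ < 1 :=
    nhdsWithin_le_nhds (hγc.norm.continuousAt.eventually_lt continuousAt_const (by simpa [hγ0]))
  have hle := le_of_tendsto_of_tendsto hlim1 hlim2 (by
    filter_upwards [hball, self_mem_nhdsWithin] with t ht ht0
    have ht0' : (0 : ℝ) < t := ht0
    have hi : (γ t).im = t := by simp [hγ, him]
    have h := hbound (γ t) ht (by rw [hi]; exact ht0'.ne')
    have hs : γ t - z₀ = t * Complex.I := by simp [hγ]
    rw [im_add_inv, hi, eval_mul, eval_pow, eval_sub, eval_X, eval_C, norm_mul, norm_pow, hs,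
      norm_mul, Complex.norm_I, Complex.norm_real, Real.norm_eq_abs, abs_mul, abs_of_pos ht0'] at h
    nlinarith)
  rw [zero_mul] at hle
  have h1 : 0 < Complex.normSq z₀ := Complex.normSq_pos.2 hz0
  have h2 : Complex.normSq z₀ < 1 := by
    rw [Complex.normSq_eq_norm_sq]; nlinarith [norm_nonneg z₀]
  have h3 : 0 < |1 - (Complex.normSq z₀)⁻¹| :=
    abs_pos.2 (by linarith [(one_lt_inv₀ h1).2 h2])
  have h4 : 0 < ‖V.eval z₀‖ := norm_pos_iff.2 hV
  nlinarith [mul_pos h3 h4]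

/-- The `M`-function of a finite-rank perturbation is rational, with polynomial Jost function and
canonical weights. -/
theorem exists_rational_of_finiteRank (hJ : IsSelfAdjoint J.operator)
    (hfin : J.FiniteRankPerturbation) :
    ∃ r : RatFunc ℂ, J.MFunctionIs r ∧ PolesInDiskRealSimple r ∧
      ∃ u : ℂ[X], (∀ z : ℂ, ‖z‖ < 1 → jostFunction r z = u.eval z) ∧
        ∀ z₀ : ℂ, ‖z₀‖ < 1 → IsPole r z₀ → HasCanonicalWeight r u z₀ := by
  obtain ⟨N, hN⟩ := finiteRankPerturbation_iff.1 hfin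
  obtain ⟨U₀, V₀, hpos, hcop, hW, hM⟩ := exists_jost_pair hN
  have hUc : ∀ z, (U₀.map (algebraMap ℝ ℂ)).eval (starRingEnd ℂ z) =
      starRingEnd ℂ ((U₀.map (algebraMap ℝ ℂ)).eval z) := fun z => by
    rw [eval_map_algebraMap, eval_map_algebraMap, Polynomial.aeval_conj]
  have hVc : ∀ z, (V₀.map (algebraMap ℝ ℂ)).eval (starRingEnd ℂ z) =
      starRingEnd ℂ ((V₀.map (algebraMap ℝ ℂ)).eval z) := fun z => by
    rw [eval_map_algebraMap, eval_map_algebraMap, Polynomial.aeval_conj]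
  have hU0r : (U₀.map (algebraMap ℝ ℂ)).eval 0 = (U₀.eval 0 : ℝ) := by
    have := Polynomial.eval_map_apply (f := algebraMap ℝ ℂ) (p := U₀) (0 : ℝ)
    simpa using this
  simp only [← eval_map_algebraMap] at hcop hW hM
  set U := U₀.map (algebraMap ℝ ℂ)
  set V := V₀.map (algebraMap ℝ ℂ)
  have hU0 : U.eval 0 = ‖U.eval 0‖ := by
    rw [hU0r, Complex.norm_real, Real.norm_of_nonneg hpos.le]
  have hU0' : U.eval 0 ≠ 0 := by
    rw [hU0r]; exact_mod_cast hpos.ne'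
  have hU : U ≠ 0 := by rintro h; simp [h] at hU0'
  have hbound := fun z hz him => norm_div_le_of_eq_m hJ hM (z := z) hz him
  have hdisk : ∀ z, ‖z‖ < 1 → U.eval z = 0 → z.im = 0 ∧ U.derivative.eval z ≠ 0 := by
    intro z hz h0
    have hz0 : z ≠ 0 := by rintro rfl; exact hU0' h0
    have him : z.im = 0 := by
      by_contra him
      obtain ⟨c, hc, hc'⟩ := im_add_inv_eq_neg hz hz0
      have hE : (z + z⁻¹).im ≠ 0 := by rw [hc']; exact mul_ne_zero (by linarith) him
      exact (hM z hz hz0 (mem_resolventSet_of_im_ne_zero hJ hE)).1 h0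
    exact ⟨him, derivative_ne_zero_of_real hbound hz hz0 him h0 fun h => hcop z ⟨h0, h⟩⟩
  -- At a zero on the circle `U(z⁻¹)` vanishes too, so the Wronskian relation gives `z = z⁻¹`.
  have hcircle : ∀ z, ‖z‖ = 1 → U.eval z = 0 → z.im = 0 ∧ U.derivative.eval z ≠ 0 := by
    intro z hz h0
    have hz0 : z ≠ 0 := by rintro rfl; simp at hz
    have h := hW z hz0
    rw [inv_eq_conj_of_norm_eq_one hz, hUc, h0] at h
    simp only [map_zero, mul_zero, zero_mul, sub_zero] at h
    have hcz : starRingEnd ℂ z = z := (sub_eq_zero.1 h.symm).symm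
    refine ⟨Complex.conj_eq_iff_im.1 hcz, derivative_ne_zero_of_wronskian hW ?_ h0⟩
    nth_rewrite 2 [← hcz]
    rw [Complex.mul_conj, Complex.normSq_eq_norm_sq, hz]
    simp
  set r := algebraMap ℂ[X] (RatFunc ℂ) V / algebraMap ℂ[X] (RatFunc ℂ) U with hr
  have heval : ∀ z, r.eval (RingHom.id ℂ) z = V.eval z / U.eval z := eval_algebraMap_div hU hcop
  have hpole : ∀ z, IsPole r z ↔ U.eval z = 0 := isPole_algebraMap_div hU hcop
  refine ⟨r, fun z hz hz0 hE => ?_, fun z hz hp => ?_, U, fun z hz => ?_, fun z₀ hz hp => ?_⟩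
  · rw [heval, (hM z hz hz0 hE).2]
  · have h0 := (hpole z).1 hp
    have h1 : z.im = 0 ∧ U.derivative.eval z ≠ 0 := by
      rcases hz.lt_or_eq with h | h
      · exact hdisk z h h0
      · exact hcircle z h h0
    refine ⟨h1.1, ?_⟩
    obtain ⟨hd1, hd2⟩ := denom_dvd_and_dvd hU hcop
    rw [← (rootMultiplicity_eq_one_iff hU h0).2 h1.2]
    exact le_antisymm (rootMultiplicity_le_rootMultiplicity_of_dvd hU hd1 z)
      (rootMultiplicity_le_rootMultiplicity_of_dvd r.denom_ne_zero hd2 z)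
  · rw [jostFunction_eq]
    have hfinS : ({ζ | U.eval ζ = 0} ∪ {ζ | ζ = 1 ∨ ζ = -1} : Set ℂ).Finite :=
      (setOf_isRoot_finite hU).union (Set.toFinite {1, -1})
    -- The weight is `log |U|²`; the resulting factor `2` cancels the half in `jostFunction_eq`. The
    -- points `±1` are excluded since `sin θ` vanishes there.
    have hI : herglotzIntegral (fun ζ => Real.log (ζ.im / (r.eval (RingHom.id ℂ) ζ).im)) z =
        herglotzIntegral (fun ζ => Real.log ‖U.eval ζ‖ + Real.log ‖U.eval ζ‖) z := by
      refine herglotzIntegral_congr hfinS (fun ζ hζ hζS => ?_) z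
      simp only [Set.mem_union, Set.mem_ofPred_eq, not_or] at hζS
      obtain ⟨hζ1, hζ2, hζ3⟩ := hζS
      have him : ζ.im ≠ 0 := by
        intro him
        have hre : ζ = (ζ.re : ℂ) := Complex.ext (by simp) (by simp [him])
        rw [hre, Complex.norm_real, Real.norm_eq_abs, abs_eq zero_le_one] at hζ
        rcases hζ with h | h
        · exact hζ2 (by rw [hre, h]; simp)
        · exact hζ3 (by rw [hre, h]; simp)
      rw [heval, im_div_of_wronskian hUc hVc hW hζ, div_div_eq_mul_div, mul_div_assoc,
        mul_comm, div_mul_cancel₀ _ him, Real.log_pow]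
      push_cast
      ring
    rw [hI, herglotzIntegral_add (circleIntegrable_log_norm_eval U)
      (circleIntegrable_log_norm_eval U) hz, add_self_div_two]
    refine blaschke_mul_exp_herglotzIntegral hU hU0 hU0' (fun w => ?_) (fun w hw => ?_) hz
    · rw [diskPoles, Finset.mem_filter, Multiset.mem_toFinset, mem_roots r.denom_ne_zero, and_comm]
      exact and_congr_right fun _ => hpole w
    · rw [diskPoles, Finset.mem_filter, Multiset.mem_toFinset, mem_roots r.denom_ne_zero] at hw
      exact (hdisk w hw.2 ((hpole w).1 hw.1)).2
  · have h0 := (hpole z₀).1 hp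
    have hz0 : z₀ ≠ 0 := by rintro rfl; exact hU0' h0
    have h1 := (hdisk z₀ hz h0).2
    -- At a zero of `U` the Wronskian relation is `V(z₀) U(z₀⁻¹) = z₀ - z₀⁻¹`, which turns the
    -- residue `V / U'` into the canonical weight.
    have h := hW z₀ hz0
    rw [h0, zero_mul, sub_zero] at h
    have hne : z₀ - z₀⁻¹ ≠ 0 := by
      intro h'
      have : ‖z₀‖ = ‖z₀‖⁻¹ := by rw [← norm_inv, ← sub_eq_zero.1 h']
      have hp : 0 < ‖z₀‖ := norm_pos_iff.2 hz0
      linarith [(one_lt_inv₀ hp).2 hz]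
    have h2 : U.eval z₀⁻¹ ≠ 0 := fun h' => hne (by rw [← h, h', mul_zero])
    refine ⟨mul_ne_zero h1 h2, ?_⟩
    simp only [heval]
    convert tendsto_sub_mul_div (V := V) h0 h1 using 2
    rw [← h, ← div_eq_mul_inv, mul_div_mul_right _ _ h2]

end JacobiMatrix

end

/-! ### The Wronskian and the degrees of the reduced solutions. -/

section

open Polynomial Filter

theorem eval_reflect {p : ℂ[X]} {n : ℕ} (hn : p.natDegree ≤ n) {z : ℂ} (hz : z ≠ 0) :
    (p.reflect n).eval z = z ^ n * p.eval z⁻¹ := by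
  let : Invertible z⁻¹ := invertibleOfNonzero (inv_ne_zero hz)
  have h := eval₂_reflect_mul_pow (RingHom.id ℂ) z⁻¹ n p hn
  rw [eval₂_id, eval₂_id, invOf_eq_inv, inv_inv] at h
  rw [← h, mul_comm, mul_assoc, ← mul_pow, inv_mul_cancel₀ hz, one_pow, mul_one]

theorem natDegree_le_of_wronskian {P Q : ℂ[X]} {c : ℂ} (hP : P.eval 0 ≠ 0) (hQ : Q ≠ 0)
    (h : ∀ z : ℂ, z ≠ 0 →
      z * Q.eval z * P.eval z⁻¹ - z⁻¹ * P.eval z * Q.eval z⁻¹ = c * (z - z⁻¹))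
    (hc : Q.natDegree ≠ 0 ∨ c = 0) : Q.natDegree + 2 ≤ P.natDegree := by
  by_contra! hlt
  set q := Q.natDegree with hq
  set p := P.natDegree with hp
  -- Clear denominators in the relation at `z⁻¹`. As `p < q + 2`, the second term vanishes at `0`,
  -- and so does the right side by `hc`; what remains is the leading coefficient of `Q` times
  -- `P(0)`.
  have hpoly : ∀ z : ℂ, z ≠ 0 → Q.reverse.eval z * P.eval z -
      z ^ (q + 2 - p) * P.reverse.eval z * Q.eval z = c * z ^ q * (1 - z ^ 2) := by
    intro z hz
    have h1 := h z⁻¹ (inv_ne_zero hz)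
    rw [inv_inv] at h1
    have hzz : z * z⁻¹ = 1 := mul_inv_cancel₀ hz
    rw [reverse, reverse, eval_reflect le_rfl hz, eval_reflect le_rfl hz]
    have e : z ^ (q + 2 - p) * z ^ p = z ^ q * z ^ 2 := by
      rw [← pow_add, ← pow_add]; congr 1; omega
    rw [← hq, ← hp]
    linear_combination (z ^ q * z) * h1 - P.eval z⁻¹ * Q.eval z * e -
      (z ^ q * Q.eval z⁻¹ * P.eval z - c * z ^ q) * hzz
  have hcont : Continuous fun z : ℂ => Q.reverse.eval z * P.eval z -
      z ^ (q + 2 - p) * P.reverse.eval z * Q.eval z - c * z ^ q * (1 - z ^ 2) :=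
    (((Q.reverse.continuous.mul P.continuous).sub
      (((continuous_id.pow _).mul P.reverse.continuous).mul Q.continuous)).sub (by fun_prop))
  have h0 : Q.reverse.eval 0 * P.eval 0 - (0 : ℂ) ^ (q + 2 - p) * P.reverse.eval 0 * Q.eval 0 -
      c * (0 : ℂ) ^ q * (1 - 0 ^ 2) = 0 := by
    have hd : Dense {z : ℂ | z ≠ 0} := dense_compl_singleton 0
    have := hcont.ext_on hd continuous_const (g := fun _ => (0 : ℂ))
      (fun z hz => sub_eq_zero.2 (hpoly z hz))
    exact congrFun this 0
  have hz1 : c * (0 : ℂ) ^ q = 0 := by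
    rcases hc with hc | hc
    · rw [zero_pow hc, mul_zero]
    · rw [hc, zero_mul]
  rw [hz1, zero_pow (by omega), zero_mul, zero_mul, zero_mul, sub_zero, sub_zero,
    ← coeff_zero_eq_eval_zero, coeff_zero_reverse] at h0
  exact mul_ne_zero (leadingCoeff_ne_zero.2 hQ) hP h0

/-- A polynomial comparable to `zᵐ` along a path to `0` is `zᵐ` times a polynomial. -/
theorem exists_eq_X_pow_mul_of_tendsto {R : ℂ[X]} {m : ℕ} {L : ℂ} (hL : L ≠ 0) {l : Filter ℝ}
    [l.NeBot] {γ : ℝ → ℂ} (hγ : Tendsto γ l (𝓝 0)) (hγ0 : ∀ᶠ t in l, γ t ≠ 0)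
    (h : Tendsto (fun t => R.eval (γ t) / γ t ^ m) l (𝓝 L)) :
    ∃ P : ℂ[X], R = X ^ m * P ∧ P.eval 0 ≠ 0 := by
  have hR : R ≠ 0 := by
    rintro rfl
    simp only [eval_zero, zero_div] at h
    exact hL (tendsto_nhds_unique h tendsto_const_nhds)
  obtain ⟨P, hP, hP0⟩ := exists_eq_pow_rootMultiplicity_mul_and_not_dvd R hR 0
  set n := R.rootMultiplicity 0
  rw [C_0, sub_zero] at hP hP0
  have hP0' : P.eval 0 ≠ 0 := by
    rwa [X_dvd_iff, coeff_zero_eq_eval_zero] at hP0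
  have hPlim : Tendsto (fun t => P.eval (γ t)) l (𝓝 (P.eval 0)) :=
    (P.continuous.tendsto 0).comp hγ
  rcases lt_trichotomy n m with hlt | heq | hgt
  · exfalso
    have h1 : Tendsto (fun t => γ t ^ (m - n) * (R.eval (γ t) / γ t ^ m)) l
        (𝓝 (0 ^ (m - n) * L)) := (hγ.pow _).mul h
    rw [zero_pow (by omega), zero_mul] at h1
    refine hP0' (tendsto_nhds_unique (hPlim.congr' ?_) h1)
    filter_upwards [hγ0] with t ht
    rw [hP, eval_mul, eval_pow, eval_X, ← mul_div_assoc, ← mul_assoc, ← pow_add,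
      Nat.sub_add_cancel hlt.le, mul_div_cancel_left₀ _ (pow_ne_zero _ ht)]
  · exact ⟨P, by rw [← heq]; exact hP, hP0'⟩
  · exfalso
    have h1 : Tendsto (fun t => γ t ^ (n - m) * P.eval (γ t)) l
        (𝓝 (0 ^ (n - m) * P.eval 0)) := (hγ.pow _).mul hPlim
    rw [zero_pow (by omega), zero_mul] at h1
    refine hL (tendsto_nhds_unique h (h1.congr' ?_))
    filter_upwards [hγ0] with t ht
    rw [hP, eval_mul, eval_pow, eval_X, eq_div_iff (pow_ne_zero _ ht), mul_right_comm, ← pow_add,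
      Nat.sub_add_cancel hgt.le]

namespace JacobiMatrix

variable {J : JacobiMatrix}

/-- The solution of the recurrence with prescribed initial values. -/
noncomputable def recSolution (J : JacobiMatrix) (E u v : ℂ) : ℕ → ℂ
  | 0 => u
  | 1 => v
  | k + 2 => ((E - J.b k) * recSolution J E u v (k + 1) -
      J.offDiag k * recSolution J E u v k) / J.a k

theorem recSolution_recurrence (E u v : ℂ) : J.Recurrence E (J.recSolution E u v) := by
  intro k
  have ha : (J.a k : ℂ) ≠ 0 := by exact_mod_cast (J.a_pos k).ne'
  rw [recSolution, mul_div_cancel₀ _ ha]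
  ring

theorem Recurrence.eq_recSolution {E : ℂ} {y : ℕ → ℂ} (hy : J.Recurrence E y) (c : ℂ) (k : ℕ) :
    c * y k = J.recSolution E (c * y 0) (c * y 1) k := by
  suffices c * y k = J.recSolution E (c * y 0) (c * y 1) k ∧
    c * y (k + 1) = J.recSolution E (c * y 0) (c * y 1) (k + 1) from this.1
  induction k with
  | zero => exact ⟨rfl, rfl⟩
  | succ k ih =>
    refine ⟨ih.2, ?_⟩
    have ha : (J.a k : ℂ) ≠ 0 := by exact_mod_cast (J.a_pos k).ne'
    rw [recSolution, ← ih.1, ← ih.2, eq_div_iff ha]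
    linear_combination c * hy k

theorem exists_polynomial_recSolution (J : JacobiMatrix) (U V : ℂ[X]) (k : ℕ) :
    ∃ R : ℂ[X], ∀ z : ℂ, z ≠ 0 →
      z ^ k * J.recSolution (z + z⁻¹) (U.eval z) (V.eval z) k = R.eval z := by
  suffices (∃ R : ℂ[X], ∀ z : ℂ, z ≠ 0 →
      z ^ k * J.recSolution (z + z⁻¹) (U.eval z) (V.eval z) k = R.eval z) ∧
      ∃ R : ℂ[X], ∀ z : ℂ, z ≠ 0 →
      z ^ (k + 1) * J.recSolution (z + z⁻¹) (U.eval z) (V.eval z) (k + 1) = R.eval z from this.1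
  induction k with
  | zero => exact ⟨⟨U, fun z _ => by simp [recSolution]⟩, ⟨X * V, fun z _ => by simp [recSolution]⟩⟩
  | succ k ih =>
    refine ⟨ih.2, ?_⟩
    obtain ⟨⟨R, hR⟩, ⟨S, hS⟩⟩ := ih
    refine ⟨C (J.a k : ℂ)⁻¹ * ((X ^ 2 + 1 - C (J.b k : ℂ) * X) * S -
      C (J.offDiag k : ℂ) * X ^ 2 * R), fun z hz => ?_⟩
    have hzz : z * z⁻¹ = 1 := mul_inv_cancel₀ hz
    simp only [eval_mul, eval_C, eval_sub, eval_add, eval_pow, eval_X, eval_one]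
    rw [← hR z hz, ← hS z hz, recSolution]
    linear_combination (J.a k : ℂ)⁻¹ * z ^ (k + 1) *
      J.recSolution (z + z⁻¹) (U.eval z) (V.eval z) (k + 1) * hzz

/-- The point `it` of the imaginary axis corresponds to the energy `i (t - t⁻¹)`. -/
theorem im_add_inv_mul_I (t : ℝ) : ((t * Complex.I + (t * Complex.I)⁻¹ : ℂ)).im = t - t⁻¹ := by
  rw [mul_inv, Complex.inv_I, ← Complex.ofReal_inv]
  simp [sub_eq_add_neg]

/-- Along the imaginary axis the resolvent solution is asymptotic to `a₁ ⋯ aₖ zᵏ`. -/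
theorem tendsto_resolventSeq (hJ : IsSelfAdjoint J.operator) {x : ℝ → SeqHilbert}
    (hx : ∀ t : ℝ, 0 < t → t < 1 →
      J.Solves (t * Complex.I + (t * Complex.I)⁻¹) (x t) deltaOne) (k : ℕ) :
    ∃ L : ℂ, L ≠ 0 ∧ Tendsto (fun t : ℝ => resolventSeq (x t) k / (t * Complex.I) ^ k) (𝓝[>] 0)
      (𝓝 L) := by
  cases k with
  | zero => exact ⟨1, one_ne_zero, by simp [resolventSeq]⟩
  | succ k =>
    set A : ℝ := ∏ j ∈ Finset.range k, J.a j with hA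
    have hApos : 0 < A := Finset.prod_pos fun j _ => J.a_pos j
    refine ⟨A, by exact_mod_cast hApos.ne', ?_⟩
    obtain ⟨C, hC⟩ := exists_resolvent_bound hJ k
    have hunit : ∀ᶠ t : ℝ in 𝓝[>] 0, 0 < t ∧ t < 1 := by
      filter_upwards [Ioo_mem_nhdsGT (one_pos : (0 : ℝ) < 1)] with t ht using ht
    have hinv : Tendsto (fun t : ℝ => t⁻¹ - t) (𝓝[>] 0) atTop := by
      refine tendsto_atTop_mono' _ ?_ (tendsto_atTop_add_const_right _ (-1) tendsto_inv_nhdsGT_zero)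
      filter_upwards [hunit] with t ht
      linarith [ht.2]
    set F : ℝ → ℂ := fun t => (t * Complex.I + (t * Complex.I)⁻¹ : ℂ) ^ (k + 1) * x t k with hF
    have hFlim : Tendsto (fun t => F t + (A : ℂ)) (𝓝[>] 0) (𝓝 0) := by
      refine squeeze_zero_norm' ?_ (hinv.const_div_atTop C)
      filter_upwards [hunit] with t ht
      have hgt : 1 < t⁻¹ := (one_lt_inv₀ ht.1).2 ht.2
      have h := hC _ _ (hx t ht.1 ht.2)
      rw [im_add_inv_mul_I, abs_sub_comm, abs_of_pos (by linarith [ht.2])] at h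
      rw [le_div_iff₀ (by linarith [ht.2]), mul_comm]
      exact h
    have hF' : Tendsto F (𝓝[>] 0) (𝓝 (-(A : ℂ))) := by
      have := hFlim.sub_const (A : ℂ)
      simpa using this
    have hG : Tendsto (fun t : ℝ => ((1 : ℂ) - t ^ 2) ^ (k + 1)) (𝓝[>] 0) (𝓝 1) := by
      have hc : Continuous fun t : ℝ => ((1 : ℂ) - t ^ 2) ^ (k + 1) := by fun_prop
      have := (hc.tendsto 0).mono_left (nhdsWithin_le_nhds (s := Set.Ioi 0))
      simpa using this
    have := (hF'.neg.div hG one_ne_zero)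
    rw [neg_neg, div_one] at this
    refine this.congr' ?_
    filter_upwards [hunit] with t ht
    have ht0 : (t : ℂ) ≠ 0 := by exact_mod_cast ht.1.ne'
    have hzne : (t * Complex.I : ℂ) ≠ 0 := mul_ne_zero ht0 Complex.I_ne_zero
    -- For `z = it`, `z E = 1 - t²` tends to `1`, which trades powers of `E` for powers of `z⁻¹`.
    have h1 : (1 : ℂ) - t ^ 2 = (t * Complex.I) * (t * Complex.I + (t * Complex.I)⁻¹) := by
      rw [mul_add, mul_inv_cancel₀ hzne]
      linear_combination (-(t : ℂ) ^ 2) * Complex.I_sq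
    have h2 : (1 : ℂ) - t ^ 2 ≠ 0 := by
      have : (1 : ℝ) - t ^ 2 ≠ 0 := by nlinarith [ht.1, ht.2]
      exact_mod_cast this
    have h3 : (t * Complex.I + (t * Complex.I)⁻¹ : ℂ) ≠ 0 := fun h => h2 (by rw [h1, h, mul_zero])
    change -F t / (1 - (t : ℂ) ^ 2) ^ (k + 1) = -x t k / (t * Complex.I) ^ (k + 1)
    rw [h1, mul_pow, hF, ← mul_neg, mul_comm (((t : ℂ) * Complex.I) ^ (k + 1)),
      mul_div_mul_left _ _ (pow_ne_zero _ h3)]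

/-- The Laurent polynomials `U ψₖ` vanish at `0` to order exactly `k`. -/
theorem exists_reduced_polynomial (hJ : IsSelfAdjoint J.operator) {U V : ℂ[X]}
    (hU : U.eval 0 ≠ 0)
    (hM : ∀ z : ℂ, ‖z‖ < 1 → z.im ≠ 0 → U.eval z * J.M z = V.eval z) (k : ℕ) :
    ∃ P : ℂ[X], P.eval 0 ≠ 0 ∧ ∀ z : ℂ, z ≠ 0 →
      J.recSolution (z + z⁻¹) (U.eval z) (V.eval z) k = z ^ k * P.eval z := by
  have hE : ∀ t : ℝ, 0 < t → t < 1 → ((t * Complex.I + (t * Complex.I)⁻¹ : ℂ)).im ≠ 0 := by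
    intro t h0 h1
    rw [im_add_inv_mul_I]
    have := (one_lt_inv₀ h0).2 h1
    linarith
  have hex : ∀ t : ℝ, ∃ x : SeqHilbert, 0 < t → t < 1 →
      J.Solves (t * Complex.I + (t * Complex.I)⁻¹) x deltaOne := by
    intro t
    by_cases h : 0 < t ∧ t < 1
    · obtain ⟨x, hx⟩ := exists_solves hJ (hE t h.1 h.2) deltaOne
      exact ⟨x, fun _ _ => hx⟩
    · exact ⟨0, fun h0 h1 => absurd ⟨h0, h1⟩ h⟩
  choose x hx using hex
  obtain ⟨L, hL, hlim⟩ := tendsto_resolventSeq hJ hx k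
  obtain ⟨R, hR⟩ := J.exists_polynomial_recSolution U V k
  have hγ : Tendsto (fun t : ℝ => (t * Complex.I : ℂ)) (𝓝[>] 0) (𝓝 0) := by
    have hc : Continuous fun t : ℝ => (t * Complex.I : ℂ) := by fun_prop
    have := (hc.tendsto 0).mono_left (nhdsWithin_le_nhds (s := Set.Ioi 0))
    simpa using this
  have hγ0 : ∀ᶠ t : ℝ in 𝓝[>] 0, (t * Complex.I : ℂ) ≠ 0 := by
    filter_upwards [self_mem_nhdsWithin] with t ht
    exact mul_ne_zero (by exact_mod_cast (ne_of_gt ht)) Complex.I_ne_zero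
  have hUlim : Tendsto (fun t : ℝ => U.eval (t * Complex.I : ℂ)) (𝓝[>] 0) (𝓝 (U.eval 0)) :=
    (U.continuous.tendsto 0).comp hγ
  -- The exponent is `2k`: `k` from clearing denominators in `R`, and `k` from the decay of the
  -- resolvent solution.
  obtain ⟨P, hP, hP0⟩ := exists_eq_X_pow_mul_of_tendsto (R := R) (m := 2 * k)
      (mul_ne_zero hU hL) hγ hγ0 ((hUlim.mul hlim).congr' (by
    filter_upwards [hγ0, Ioo_mem_nhdsGT (one_pos : (0 : ℝ) < 1)] with t ht ht1
    have hs := hx t ht1.1 ht1.2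
    have hm := m_eq (mem_resolventSet_of_im_ne_zero hJ (hE t ht1.1 ht1.2)) hs
    have hn : ‖(t * Complex.I : ℂ)‖ < 1 := by
      simpa [abs_of_pos ht1.1] using ht1.2
    have hMt := hM _ hn (by simpa using ht1.1.ne')
    rw [M, hm] at hMt
    have hrec := hs.recurrence.eq_recSolution (U.eval (t * Complex.I : ℂ)) k
    change _ = J.recSolution _ (_ * 1) (_ * -x t 0) k at hrec
    rw [mul_one, hMt] at hrec
    rw [← hR _ ht, ← hrec, two_mul, pow_add, mul_div_mul_left _ _ (pow_ne_zero _ ht),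
      mul_div_assoc]))
  refine ⟨P, hP0, fun z hz => ?_⟩
  have h := hR z hz
  rw [hP, eval_mul, eval_pow, eval_X, two_mul, pow_add, mul_assoc] at h
  exact mul_left_cancel₀ (pow_ne_zero _ hz) h

/-- If `M = V / U` with polynomials whose Wronskian is `c (z - z⁻¹)`, then the Jacobi parameters
are eventually free. -/
theorem eventually_free_of_wronskian (hJ : IsSelfAdjoint J.operator) {U V : ℂ[X]} {c : ℂ}
    (hU : U.eval 0 ≠ 0)
    (hM : ∀ z : ℂ, ‖z‖ < 1 → z.im ≠ 0 → U.eval z * J.M z = V.eval z)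
    (hW : ∀ z : ℂ, z ≠ 0 → V.eval z * U.eval z⁻¹ - U.eval z * V.eval z⁻¹ = c * (z - z⁻¹)) :
    c ≠ 0 ∧ ∃ N, ∀ n, N ≤ n → J.a n = 1 ∧ J.b n = 0 := by
  choose P hP0 hP using exists_reduced_polynomial hJ hU hM
  have hrec : ∀ z : ℂ, z ≠ 0 → J.Recurrence (z + z⁻¹) fun k => z ^ k * (P k).eval z := by
    intro z hz
    have := J.recSolution_recurrence (z + z⁻¹) (U.eval z) (V.eval z)
    rwa [show J.recSolution (z + z⁻¹) (U.eval z) (V.eval z) = fun k => z ^ k * (P k).eval z from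
      funext fun k => hP k z hz] at this
  have hwr : ∀ k, ∀ z : ℂ, z ≠ 0 → z * (P (k + 1)).eval z * (P k).eval z⁻¹ -
      z⁻¹ * (P k).eval z * (P (k + 1)).eval z⁻¹ = c / J.offDiag k * (z - z⁻¹) := by
    intro k z hz
    have ha : (J.offDiag k : ℂ) ≠ 0 := by exact_mod_cast (J.offDiag_pos k).ne'
    have h2 := hrec z⁻¹ (inv_ne_zero hz)
    rw [inv_inv, add_comm] at h2
    have h := (hrec z hz).wronskian h2 k
    have e0 : U.eval z = _ := hP 0 z hz
    have e1 : V.eval z = _ := hP 1 z hz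
    have e0' : U.eval z⁻¹ = _ := hP 0 z⁻¹ (inv_ne_zero hz)
    have e1' : V.eval z⁻¹ = _ := hP 1 z⁻¹ (inv_ne_zero hz)
    simp only [← e0, ← e1, ← e0', ← e1', hW z hz] at h
    have hzk : z ^ k * z⁻¹ ^ k = 1 := by rw [← mul_pow, mul_inv_cancel₀ hz, one_pow]
    rw [div_mul_eq_mul_div, eq_div_iff ha, ← h, pow_succ, pow_succ]
    linear_combination -(J.offDiag k : ℂ) * (z * (P (k + 1)).eval z * (P k).eval z⁻¹ -
      z⁻¹ * (P k).eval z * (P (k + 1)).eval z⁻¹) * hzk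
  have hdeg : ∀ k, (P (k + 1)).natDegree ≠ 0 ∨ c = 0 →
      (P (k + 1)).natDegree + 2 ≤ (P k).natDegree := by
    intro k hk
    refine natDegree_le_of_wronskian (hP0 k) (fun h => hP0 (k + 1) (by rw [h, eval_zero]))
      (hwr k) (hk.imp_right fun h => by rw [h, zero_div])
  obtain ⟨n₀, hn₀⟩ : ∃ n, (P n).natDegree = 0 := by
    by_contra! hne
    have : ∀ k, (P k).natDegree + k ≤ (P 0).natDegree := by
      intro k
      induction k with
      | zero => simp
      | succ k ih => have := hdeg k (Or.inl (hne _)); omega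
    have := this ((P 0).natDegree + 1)
    omega
  -- With zero Wronskian the degree would have to drop even below a constant.
  have hc : c ≠ 0 := by
    intro hc
    have := hdeg n₀ (Or.inr hc)
    omega
  refine ⟨hc, ?_⟩
  have hconst : ∀ j, (P (n₀ + j)).natDegree = 0 := by
    intro j
    induction j with
    | zero => exact hn₀
    | succ j ih =>
      by_contra hne
      have := hdeg (n₀ + j) (Or.inl hne)
      omega
  have hev : ∀ k, n₀ ≤ k → ∀ z, (P k).eval z = (P k).eval 0 := by
    intro k hk z
    obtain ⟨j, rfl⟩ := Nat.exists_eq_add_of_le hk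
    rw [eq_C_of_natDegree_eq_zero (hconst j)]
    simp
  -- Once the `Pₖ` are constant the recurrence is a quadratic identity in `z`; sampling at `1`,
  -- `-1`, `2` separates its coefficients.
  have hquad : ∀ k, n₀ ≤ k → ∀ z : ℂ, z ≠ 0 → (J.a k : ℂ) * (P (k + 2)).eval 0 * z ^ 2 +
      J.b k * (P (k + 1)).eval 0 * z + J.offDiag k * (P k).eval 0 =
        (z ^ 2 + 1) * (P (k + 1)).eval 0 := by
    intro k hk z hz
    have h := hrec z hz k
    simp only [hev k hk, hev (k + 1) (by omega), hev (k + 2) (by omega)] at h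
    apply mul_left_cancel₀ (pow_ne_zero k hz)
    have hzz : z * z⁻¹ = 1 := mul_inv_cancel₀ hz
    linear_combination h + z ^ k * (P (k + 1)).eval 0 * hzz
  have h1 : ∀ k, n₀ ≤ k → (J.b k : ℂ) * (P (k + 1)).eval 0 = 0 ∧
      (J.a k : ℂ) * (P (k + 2)).eval 0 = (P (k + 1)).eval 0 ∧
      (J.offDiag k : ℂ) * (P k).eval 0 = (P (k + 1)).eval 0 := by
    intro k hk
    have e1 := hquad k hk 1 one_ne_zero
    have e2 := hquad k hk (-1) (by norm_num)
    have e3 := hquad k hk 2 two_ne_zero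
    have eb : (J.b k : ℂ) * (P (k + 1)).eval 0 = 0 := by linear_combination (e1 - e2) / 2
    have ea : (J.a k : ℂ) * (P (k + 2)).eval 0 = (P (k + 1)).eval 0 := by
      linear_combination (e3 - e1 - eb) / 3
    exact ⟨eb, ea, by linear_combination e1 - eb - ea⟩
  refine ⟨n₀, fun n hn => ?_⟩
  obtain ⟨hb, ha, -⟩ := h1 n hn
  obtain ⟨-, -, ho⟩ := h1 (n + 1) (by omega)
  rw [offDiag] at ho
  have hne := hP0 (n + 1)
  have hb' : J.b n = 0 := by simpa [hne] using hb
  -- `a n` occurs as the upper coefficient at `n` and the lower one at `n + 1`, and so maps the two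
  -- constants to each other.
  have hsq : (J.a n : ℂ) * J.a n = 1 := by
    apply mul_right_cancel₀ hne
    linear_combination (J.a n : ℂ) * ho + ha
  have hsq' : J.a n * J.a n = 1 := by exact_mod_cast hsq
  exact ⟨by nlinarith [J.a_pos n], hb'⟩

end JacobiMatrix

end

/-! ### The denominator of `M` divides the Jost polynomial. -/

section

open Polynomial Filter

theorem Polynomial.eq_of_eval_imaginary {p q : ℂ[X]}
    (h : ∀ t : ℝ, 0 < t → t < 1 → p.eval (t * Complex.I) = q.eval (t * Complex.I)) : p = q := by
  refine eq_of_infinite_eval_eq p q ?_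
  have hinj : Function.Injective fun t : ℝ => (t * Complex.I : ℂ) := fun s t hst => by
    simpa using hst
  refine ((Set.Ioo_infinite (one_pos : (0 : ℝ) < 1)).image hinj.injOn).mono ?_
  rintro _ ⟨t, ht, rfl⟩
  exact h t ht.1 ht.2

theorem mul_I_ne_zero_of_pos {t : ℝ} (ht : 0 < t) : (t * Complex.I : ℂ) ≠ 0 :=
  mul_ne_zero (by exact_mod_cast ht.ne') Complex.I_ne_zero

theorem Polynomial.eq_of_eval_ne_zero {p q : ℂ[X]} (h : ∀ z : ℂ, z ≠ 0 → p.eval z = q.eval z) :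
    p = q :=
  eq_of_eval_imaginary fun _ ht _ => h _ (mul_I_ne_zero_of_pos ht)

/-- The linear factor of the reflected polynomial at the inverse of a root. -/
theorem reflect_eq_of_isRoot {p : ℂ[X]} {n : ℕ} {ζ : ℂ} (hζ : ζ ≠ 0) (hp : p.eval ζ = 0)
    (hp0 : p ≠ 0) (hn : p.natDegree ≤ n) :
    ∃ q : ℂ[X], p.reflect n = (X - C ζ⁻¹) * q ∧
      q.eval ζ⁻¹ * ζ⁻¹ = -(ζ * ζ⁻¹ ^ n * p.derivative.eval ζ) := by
  obtain ⟨p₁, rfl⟩ := dvd_iff_isRoot.2 hp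
  have hp1 : p₁ ≠ 0 := right_ne_zero_of_mul hp0
  rw [natDegree_mul (X_sub_C_ne_zero ζ) hp1, natDegree_X_sub_C] at hn
  obtain ⟨m, rfl⟩ : ∃ m, n = m + 1 := ⟨n - 1, by omega⟩
  have hm : p₁.natDegree ≤ m := by omega
  refine ⟨C (-ζ) * p₁.reflect m, eq_of_eval_ne_zero fun z hz => ?_, ?_⟩
  · rw [eval_reflect (by rw [natDegree_mul (X_sub_C_ne_zero ζ) hp1, natDegree_X_sub_C]; omega) hz]
    simp only [eval_mul, eval_sub, eval_X, eval_C]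
    rw [eval_reflect hm hz]
    have hzz : z * z⁻¹ = 1 := mul_inv_cancel₀ hz
    have hζζ : ζ * ζ⁻¹ = 1 := mul_inv_cancel₀ hζ
    linear_combination z ^ m * p₁.eval z⁻¹ * hzz - z ^ m * p₁.eval z⁻¹ * hζζ
  · have hζζ : ζ * ζ⁻¹ = 1 := mul_inv_cancel₀ hζ
    rw [eval_mul, eval_C, eval_reflect hm (inv_ne_zero hζ), inv_inv, derivative_mul, eval_add,
      eval_mul, eval_mul]
    simp only [derivative_sub, derivative_X, derivative_C, sub_zero, eval_one, one_mul, eval_sub,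
      eval_X, eval_C, sub_self, zero_mul, add_zero]
    ring

theorem exists_eq_linear_mul {p : ℂ[X]} {w : ℂ} (h : p.eval w = 0) :
    ∃ q : ℂ[X], p = (X - C w) * q ∧ q.eval w = p.derivative.eval w := by
  obtain ⟨q, rfl⟩ := dvd_iff_isRoot.2 h
  exact ⟨q, rfl, by simp [derivative_mul]⟩

/-- The factorization of the circle identity together with the canonical weights forces the
denominator of `M` to divide the Jost polynomial. -/
theorem denom_dvd_of_canonical {D N u : ℂ[X]} (hcop : ∀ z, ¬ (D.eval z = 0 ∧ N.eval z = 0))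
    (hD : D ≠ 0) (hD0 : D.eval 0 ≠ 0) (hu : u ≠ 0)
    (hsimple : ∀ z : ℂ, ‖z‖ ≤ 1 → D.eval z = 0 → z.im = 0 ∧ D.derivative.eval z ≠ 0)
    (hzero : ∀ z : ℂ, ‖z‖ < 1 → (u.eval z = 0 ↔ D.eval z = 0))
    (hcan : ∀ z : ℂ, ‖z‖ < 1 → D.eval z = 0 → u.derivative.eval z * u.eval z⁻¹ ≠ 0 ∧
      N.eval z * (u.derivative.eval z * u.eval z⁻¹) = (z - z⁻¹) * D.derivative.eval z)
    (hA : ∀ z : ℂ, z ≠ 0 → u.eval z * u.eval z⁻¹ * (N.eval z * D.eval z⁻¹ - N.eval z⁻¹ * D.eval z) =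
      (z - z⁻¹) * (D.eval z * D.eval z⁻¹)) : D ∣ u := by
  set n := max (max D.natDegree N.natDegree) u.natDegree with hn
  have hDn : D.natDegree ≤ n := (le_max_left _ _).trans (le_max_left _ _)
  have hNn : N.natDegree ≤ n := (le_max_right _ _).trans (le_max_left _ _)
  have hun : u.natDegree ≤ n := le_max_right _ _
  have hpoly : X * u * u.reflect n * (N * D.reflect n - N.reflect n * D) =
      X ^ n * (X ^ 2 - 1) * D * D.reflect n := by
    refine eq_of_eval_ne_zero fun z hz => ?_
    simp only [eval_mul, eval_sub, eval_pow, eval_X, eval_one]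
    rw [eval_reflect hDn hz, eval_reflect hNn hz, eval_reflect hun hz]
    have hzz : z * z⁻¹ = 1 := mul_inv_cancel₀ hz
    linear_combination z ^ n * z ^ n * z * hA z hz -
      z ^ n * z ^ n * D.eval z * D.eval z⁻¹ * hzz
  rw [IsAlgClosed.dvd_iff_roots_le_roots hD hu, Multiset.le_iff_count]
  intro w
  rw [count_roots, count_roots]
  by_cases hw : D.eval w = 0
  swap
  · rw [rootMultiplicity_eq_zero hw]; exact Nat.zero_le _
  have hw0 : w ≠ 0 := by rintro rfl; exact hD0 hw
  have hww : w * w⁻¹ = 1 := mul_inv_cancel₀ hw0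
  have hNw : N.eval w ≠ 0 := fun h => hcop w ⟨hw, h⟩
  have hone : ‖w‖ ≤ 1 → u.eval w = 0 → D.rootMultiplicity w ≤ u.rootMultiplicity w := by
    intro h1 h2
    rw [(rootMultiplicity_eq_one_iff hD hw).2 (hsimple w h1 hw).2]
    exact (rootMultiplicity_pos hu).2 h2
  rcases lt_trichotomy ‖w‖ 1 with hlt | heq | hgt
  · exact hone hlt.le ((hzero w hlt).2 hw)
  -- Here `w = ±1` is its own inverse. If `u(w) ≠ 0`, dividing `hpoly` by `X - w` leaves a nonzero
  -- multiple of `u(w)² N(w) D'(w)` on the left and zero on the right.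
  · refine hone heq.le ?_
    obtain ⟨him, hD'⟩ := hsimple w heq.le hw
    have hsq : w * w = 1 := by
      nth_rewrite 2 [← Complex.conj_eq_iff_im.2 him]
      rw [Complex.mul_conj, Complex.normSq_eq_norm_sq, heq]
      simp
    have hinv : w⁻¹ = w := inv_eq_of_mul_eq_one_left hsq
    by_contra huw
    obtain ⟨D₁, hD₁, hD₁w⟩ := exists_eq_linear_mul hw
    obtain ⟨D₂, hD₂, hD₂w⟩ := reflect_eq_of_isRoot hw0 hw hD hDn
    rw [hinv] at hD₂ hD₂w
    have hcancel : X * u * u.reflect n * (N * D₂ - N.reflect n * D₁) =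
        X ^ n * (X ^ 2 - 1) * D₁ * ((X - C w) * D₂) := by
      apply mul_left_cancel₀ (X_sub_C_ne_zero w)
      rw [hD₂] at hpoly
      linear_combination hpoly + (X * u * u.reflect n * N.reflect n +
        X ^ n * (X ^ 2 - 1) * ((X - C w) * D₂)) * hD₁
    have h := congrArg (eval w) hcancel
    simp only [eval_mul, eval_sub, eval_pow, eval_X, eval_one, eval_C, sub_self, zero_mul,
      mul_zero] at h
    rw [eval_reflect hun hw0, eval_reflect hNn hw0, hinv, hD₁w] at h
    have hwn : w ^ n ≠ 0 := pow_ne_zero _ hw0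
    have h2 : D₂.eval w = -(w ^ n * D.derivative.eval w) := by
      apply mul_right_cancel₀ hw0
      linear_combination hD₂w
    rw [h2] at h
    have h3 : w * u.eval w * (w ^ n * u.eval w) * (2 * N.eval w * (w ^ n * D.derivative.eval w)) =
        0 := by linear_combination -h
    simp [hw0, huw, hNw, hD', hwn] at h3
  · have hζ : ‖w⁻¹‖ < 1 := by rw [norm_inv]; exact inv_lt_one_of_one_lt₀ hgt
    have hζ0 : w⁻¹ ≠ 0 := inv_ne_zero hw0
    have hwn : w ^ n ≠ 0 := pow_ne_zero _ hw0
    by_cases hDζ : D.eval w⁻¹ = 0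
    -- Poles at both `w` and `w⁻¹`: divide `hpoly` by `(X - w)²` and evaluate at `w`. The canonical
    -- weight at `w⁻¹` makes one term on the left equal to the right side, so the other, a product
    -- of nonzero factors, would vanish.
    · exfalso
      obtain ⟨hc1, hc2⟩ := hcan _ hζ hDζ
      rw [inv_inv] at hc1 hc2
      have huζ := (hzero _ hζ).2 hDζ
      have hD' := (hsimple _ hζ.le hDζ).2
      have huw : u.eval w ≠ 0 := right_ne_zero_of_mul hc1
      have hu' : u.derivative.eval w⁻¹ ≠ 0 := left_ne_zero_of_mul hc1
      obtain ⟨D₁, hD₁, hD₁w⟩ := exists_eq_linear_mul hw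
      obtain ⟨D₂, hD₂, hD₂w⟩ := reflect_eq_of_isRoot hζ0 hDζ hD hDn
      obtain ⟨U₂, hU₂, hU₂w⟩ := reflect_eq_of_isRoot hζ0 huζ hu hun
      rw [inv_inv] at hD₂ hD₂w hU₂ hU₂w
      have hcancel : X * u * U₂ * (N * D₂ - N.reflect n * D₁) =
          X ^ n * (X ^ 2 - 1) * D₁ * D₂ := by
        apply mul_left_cancel₀ (mul_ne_zero (X_sub_C_ne_zero w) (X_sub_C_ne_zero w))
        rw [hD₂, hU₂] at hpoly
        linear_combination hpoly + (X * u * ((X - C w) * U₂) * N.reflect n +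
          X ^ n * (X ^ 2 - 1) * ((X - C w) * D₂)) * hD₁
      have h := congrArg (eval w) hcancel
      simp only [eval_mul, eval_sub, eval_pow, eval_X, eval_one] at h
      rw [eval_reflect hNn hw0] at h
      have h3 : w * w * (w * u.eval w * U₂.eval w * (N.eval w * D₂.eval w)) = 0 := by
        linear_combination w * w * h + w ^ n * w * w * u.eval w * N.eval w⁻¹ * D₁.eval w * hU₂w -
          w ^ n * w ^ n * w * D₁.eval w * hc2 * (w * w⁻¹) +
          w ^ n * w * (w ^ 2 - 1) * D₁.eval w * hD₂w -
          w ^ n * w ^ n * w * w⁻¹ * D₁.eval w * D.derivative.eval w⁻¹ * hww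
      have hD₂0 : D₂.eval w ≠ 0 := by
        intro h0
        rw [h0, zero_mul, eq_comm, neg_eq_zero] at hD₂w
        simp [hw0, hD'] at hD₂w
      have hU₂0 : U₂.eval w ≠ 0 := by
        intro h0
        rw [h0, zero_mul, eq_comm, neg_eq_zero] at hU₂w
        simp [hw0, hu'] at hU₂w
      simp [hw0, huw, hU₂0, hNw, hD₂0] at h3
    · have huζ : u.eval w⁻¹ ≠ 0 := fun h => hDζ ((hzero _ hζ).1 h)
      rw [le_rootMultiplicity_iff hu]
      -- The cofactor of `u` does not vanish at `w`, so the whole multiplicity of `w` in `D` passes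
      -- to `u`.
      have hdvd : D ∣ (X * u.reflect n * N * D.reflect n) * u :=
        ⟨X ^ n * (X ^ 2 - 1) * D.reflect n + X * u * u.reflect n * N.reflect n, by
          linear_combination hpoly⟩
      refine IsCoprime.dvd_of_dvd_mul_left (IsCoprime.pow_left ?_)
        ((pow_rootMultiplicity_dvd D w).trans hdvd)
      rw [(irreducible_X_sub_C w).coprime_iff_not_dvd, dvd_iff_isRoot, IsRoot]
      simp only [eval_mul, eval_X]
      rw [eval_reflect hun hw0, eval_reflect hDn hw0]
      exact mul_ne_zero (mul_ne_zero (mul_ne_zero hw0 (mul_ne_zero hwn huζ)) hNw)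
        (mul_ne_zero hwn hDζ)

end

/-! ### From a polynomial Jost function and canonical weights back to finite rank. -/

section

open Polynomial Filter

/-- The Herglotz integral of a conjugation-invariant function commutes with conjugation. -/
theorem herglotzIntegral_conj {g : ℂ → ℝ} (hg : ∀ ζ : ℂ, ‖ζ‖ = 1 → g (starRingEnd ℂ ζ) = g ζ)
    (z : ℂ) : herglotzIntegral g (starRingEnd ℂ z) = starRingEnd ℂ (herglotzIntegral g z) := by
  have h1 : herglotzIntegral g (starRingEnd ℂ z) =
      Real.circleAverage (fun ζ => starRingEnd ℂ (herglotzRieszKernel 0 z ζ • (g ζ : ℂ))) 0 1 := by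
    rw [herglotzIntegral, ← Real.circleAverage_zero_one_congr_inv]
    refine Real.circleAverage_congr_sphere fun ζ hζ => ?_
    have hζ' : ‖ζ‖ = 1 := by simpa using hζ
    simp only [inv_eq_conj_of_norm_eq_one hζ', hg ζ hζ', herglotzRieszKernel_def, smul_eq_mul,
      map_mul, map_div₀, map_add, map_sub, Complex.conj_ofReal, map_zero]
  rw [h1, herglotzIntegral, Real.circleAverage_def, Real.circleAverage_def, Complex.real_smul,
    Complex.real_smul, map_mul, Complex.conj_ofReal]
  congr 1
  exact intervalIntegral.intervalIntegral_conj

/-- The exponential of the Herglotz integral of the log-modulus of a rational function is a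
quotient of polynomials with the same moduli on the circle. -/
theorem exp_herglotzIntegral_quotient {W : ℂ → ℝ} {A Q : ℂ[X]} (hA : A ≠ 0) (hQ : Q ≠ 0)
    {S : Set ℂ} (hS : S.Finite)
    (h : ∀ ζ : ℂ, ‖ζ‖ = 1 → ζ ∉ S → W ζ = Real.log ‖A.eval ζ‖ - Real.log ‖Q.eval ζ‖) :
    ∃ F G : ℂ[X], (∀ ζ : ℂ, ‖ζ‖ = 1 → ‖F.eval ζ‖ = ‖A.eval ζ‖) ∧
      (∀ ζ : ℂ, ‖ζ‖ = 1 → ‖G.eval ζ‖ = ‖Q.eval ζ‖) ∧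
      ∀ z : ℂ, ‖z‖ < 1 → Complex.exp (herglotzIntegral W z) * G.eval z = F.eval z := by
  obtain ⟨A', hA', hAn⟩ := exists_zeroFree_norm_eq hA
  obtain ⟨Q', hQ', hQn⟩ := exists_zeroFree_norm_eq hQ
  have hphase : ∀ p : ℂ[X], p.eval 0 ≠ 0 → ‖(‖p.eval 0‖ / p.eval 0 : ℂ)‖ = 1 := by
    intro p hp
    rw [norm_div, Complex.norm_real, norm_norm, div_self (norm_ne_zero_iff.2 hp)]
  refine ⟨C (‖A'.eval 0‖ / A'.eval 0 : ℂ) * A', C (‖Q'.eval 0‖ / Q'.eval 0 : ℂ) * Q',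
    fun ζ hζ => ?_, fun ζ hζ => ?_, fun z hz => ?_⟩
  · rw [eval_mul, eval_C, norm_mul, hphase A' (hA' 0 (by simp)), one_mul, hAn ζ hζ]
  · rw [eval_mul, eval_C, norm_mul, hphase Q' (hQ' 0 (by simp)), one_mul, hQn ζ hζ]
  · rw [eval_mul, eval_C, eval_mul, eval_C, ← exp_herglotzIntegral_log_norm_eval hA' hz,
      ← exp_herglotzIntegral_log_norm_eval hQ' hz, ← Complex.exp_add]
    have hint : CircleIntegrable (fun ζ => Real.log ‖A'.eval ζ‖ - Real.log ‖Q'.eval ζ‖) 0 1 :=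
      (circleIntegrable_log_norm_eval A').sub (circleIntegrable_log_norm_eval Q')
    have h1 : herglotzIntegral W z = herglotzIntegral
        (fun ζ => Real.log ‖A'.eval ζ‖ - Real.log ‖Q'.eval ζ‖) z :=
      herglotzIntegral_congr hS (fun ζ hζ hζS => by rw [h ζ hζ hζS, hAn ζ hζ, hQn ζ hζ]) z
    rw [h1, ← herglotzIntegral_add hint (circleIntegrable_log_norm_eval Q') hz]
    simp only [sub_add_cancel]

theorem mem_diskPoles_iff {r : RatFunc ℂ} {w : ℂ} :
    w ∈ diskPoles r ↔ ‖w‖ < 1 ∧ r.denom.eval w = 0 := by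
  rw [diskPoles, Finset.mem_filter, Multiset.mem_toFinset, mem_roots r.denom_ne_zero, and_comm,
    IsRoot]

theorem jostFunction_eq_zero_iff {r : RatFunc ℂ} (h0 : r.denom.eval 0 ≠ 0) {z : ℂ}
    (hz : ‖z‖ < 1) : jostFunction r z = 0 ↔ r.denom.eval z = 0 := by
  rw [jostFunction_eq, mul_eq_zero, or_iff_left (Complex.exp_ne_zero _), Finset.prod_eq_zero_iff]
  constructor
  · rintro ⟨w, hw, hw'⟩
    obtain ⟨hw1, hw2⟩ := mem_diskPoles_iff.1 hw
    have hw0 : w ≠ 0 := by rintro rfl; exact h0 hw2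
    rw [blaschkeFactor, if_neg hw0, mul_eq_zero, div_eq_zero_iff, div_eq_zero_iff] at hw'
    have h1 := one_sub_conj_mul_ne_zero hw1 hz
    have h2 : w - z = 0 := by simpa [hw0, h1] using hw'
    rwa [← sub_eq_zero.1 h2]
  · intro h
    have hz0 : z ≠ 0 := by rintro rfl; exact h0 h
    exact ⟨z, mem_diskPoles_iff.2 ⟨hz, h⟩, by rw [blaschkeFactor, if_neg hz0]; simp⟩

/-- The modulus on the circle of a polynomial Jost function. -/
theorem norm_jost_sq {r : RatFunc ℂ} (h0 : r.denom.eval 0 ≠ 0) {u A Q : ℂ[X]}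
    (hu : ∀ z : ℂ, ‖z‖ < 1 → jostFunction r z = u.eval z) (hA : A ≠ 0) (hQ : Q ≠ 0)
    {S : Set ℂ} (hS : S.Finite)
    (h : ∀ ζ : ℂ, ‖ζ‖ = 1 → ζ ∉ S → Real.log (ζ.im / (r.eval (RingHom.id ℂ) ζ).im) =
      Real.log ‖A.eval ζ‖ - Real.log ‖Q.eval ζ‖) {ζ : ℂ} (hζ : ‖ζ‖ = 1) :
    ‖u.eval ζ‖ ^ 2 * ‖Q.eval ζ‖ = ‖A.eval ζ‖ := by
  obtain ⟨F, G, hF, hG, hFG⟩ := exp_herglotzIntegral_quotient hA hQ hS h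
  set T := diskPoles r with hT
  have hT0 : (0 : ℂ) ∉ T := fun h => h0 (mem_diskPoles_iff.1 h).2
  have hT1 : ∀ w ∈ T, ‖w‖ < 1 := fun w hw => (mem_diskPoles_iff.1 hw).1
  set B₁ : ℂ[X] := ∏ w ∈ T, (1 - C (starRingEnd ℂ w) * X) with hB₁
  set B₂ : ℂ[X] := ∏ w ∈ T, (C ((‖w‖ : ℂ) / w) * (C w - X)) with hB₂
  have e1 : ∀ z, B₁.eval z = ∏ w ∈ T, (1 - starRingEnd ℂ w * z) := fun z => by
    simp [hB₁, eval_prod]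
  have e2 : ∀ z, B₂.eval z = ∏ w ∈ T, ((‖w‖ : ℂ) / w * (w - z)) := fun z => by
    simp [hB₂, eval_prod]
  -- Squaring removes the half in the exponent. Being polynomial, the identity passes from the disk
  -- to the circle, where `B₁` and `B₂` have equal modulus.
  have hpoly : u ^ 2 * G * B₁ ^ 2 = B₂ ^ 2 * F := by
    refine eq_of_eval_imaginary fun t ht ht1 => ?_
    have hz : ‖(t * Complex.I : ℂ)‖ < 1 := by simpa [abs_of_pos ht] using ht1
    generalize (t * Complex.I : ℂ) = z at hz
    simp only [eval_mul, eval_pow]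
    have hb := prod_blaschke_mul hT0 hT1 hz
    have he : Complex.exp (herglotzIntegral
        (fun ζ => Real.log (ζ.im / (r.eval (RingHom.id ℂ) ζ).im)) z / 2) ^ 2 =
        Complex.exp (herglotzIntegral
        (fun ζ => Real.log (ζ.im / (r.eval (RingHom.id ℂ) ζ).im)) z) := by
      rw [← Complex.exp_nat_mul]
      congr 1
      push_cast
      ring
    rw [← hu z hz, jostFunction_eq, e1, e2, ← hb, ← hFG z hz, ← he]
    ring
  have hn := congrArg (fun p => ‖p.eval ζ‖) hpoly
  simp only [eval_mul, eval_pow, norm_mul, norm_pow] at hn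
  have hBn : ‖B₁.eval ζ‖ = ‖B₂.eval ζ‖ := by
    rw [e1, e2, norm_prod, norm_prod]
    refine Finset.prod_congr rfl fun w hw => ?_
    have hw0 : ‖w‖ ≠ 0 := norm_ne_zero_iff.2 fun h => hT0 (h ▸ hw)
    rw [norm_one_sub_conj_mul hζ, norm_mul, norm_div, Complex.norm_real, norm_norm,
      div_self hw0, one_mul, norm_sub_rev]
  have hB0 : ‖B₁.eval ζ‖ ≠ 0 := by
    rw [e1, norm_prod, Finset.prod_ne_zero_iff]
    intro w hw
    rw [norm_one_sub_conj_mul hζ, norm_ne_zero_iff, sub_ne_zero]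
    rintro rfl
    exact (hT1 _ hw).ne hζ
  rw [hF ζ hζ, hG ζ hζ, ← hBn, mul_comm (‖B₁.eval ζ‖ ^ 2)] at hn
  exact mul_right_cancel₀ (pow_ne_zero 2 hB0) hn

theorem blaschkeFactor_conj {z w : ℂ} (hw : w.im = 0) :
    blaschkeFactor (starRingEnd ℂ z) w = starRingEnd ℂ (blaschkeFactor z w) := by
  have hc : starRingEnd ℂ w = w := Complex.conj_eq_iff_im.2 hw
  rw [blaschkeFactor, blaschkeFactor]
  split_ifs with h
  · rfl
  · simp [hc]

theorem eval_map_conj (p : ℂ[X]) (z : ℂ) :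
    (p.map (starRingEnd ℂ)).eval z = starRingEnd ℂ (p.eval (starRingEnd ℂ z)) := by
  have := Polynomial.eval_map_apply (f := starRingEnd ℂ) (p := p) (starRingEnd ℂ z)
  rwa [Complex.conj_conj] at this

/-- The disk poles are real and the weight is invariant under conjugation. This is what turns `|u|²`
on the circle into `u(ζ) u(ζ⁻¹)`. -/
theorem jost_conj {r : RatFunc ℂ} (hr : ∀ z, r.eval (RingHom.id ℂ) (starRingEnd ℂ z) =
      starRingEnd ℂ (r.eval (RingHom.id ℂ) z)) (hp : PolesInDiskRealSimple r) {u : ℂ[X]}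
    (hu : ∀ z : ℂ, ‖z‖ < 1 → jostFunction r z = u.eval z) (z : ℂ) :
    u.eval (starRingEnd ℂ z) = starRingEnd ℂ (u.eval z) := by
  have hmap : u.map (starRingEnd ℂ) = u := by
    refine eq_of_eval_imaginary fun t ht ht1 => ?_
    have hz : ‖(t * Complex.I : ℂ)‖ < 1 := by simpa [abs_of_pos ht] using ht1
    generalize (t * Complex.I : ℂ) = z at hz
    rw [eval_map_conj, ← hu z hz, ← hu _ (by rwa [RCLike.norm_conj]), jostFunction_eq,
      jostFunction_eq, herglotzIntegral_conj, map_mul, map_prod, ← Complex.exp_conj, map_div₀,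
      Complex.conj_conj]
    · congr 1
      · refine Finset.prod_congr rfl fun w hw => ?_
        obtain ⟨hw1, hw2⟩ := mem_diskPoles_iff.1 hw
        rw [blaschkeFactor_conj (hp w hw1.le hw2).1, Complex.conj_conj]
      · rw [map_ofNat]
    · intro ζ _
      rw [hr, Complex.conj_im, Complex.conj_im, neg_div_neg_eq]
  have h := eval_map_conj u (starRingEnd ℂ z)
  rwa [hmap, Complex.conj_conj] at h

theorem sphere_infinite : {ζ : ℂ | ‖ζ‖ = 1}.Infinite := by
  have h1 : IsPreconnected (Metric.sphere (0 : ℂ) 1) :=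
    isPreconnected_sphere (by rw [Complex.rank_real_complex]; exact Nat.one_lt_ofNat) 0 1
  have h2 : (Metric.sphere (0 : ℂ) 1).Nontrivial :=
    ⟨1, by simp, -1, by simp, by norm_num⟩
  refine (h1.infinite_of_nontrivial h2).mono fun ζ hζ => by simpa using hζ

namespace JacobiMatrix

variable {J : JacobiMatrix}

section Rational

variable {r : RatFunc ℂ}

theorem MFunctionIs.eq_div (hJ : IsSelfAdjoint J.operator) (hr : J.MFunctionIs r)
    (hp : PolesInDiskRealSimple r) {z : ℂ} (hz : ‖z‖ < 1) (him : z.im ≠ 0) :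
    r.denom.eval z ≠ 0 ∧ J.M z = r.num.eval z / r.denom.eval z := by
  have hz0 : z ≠ 0 := by rintro rfl; simp at him
  obtain ⟨c, hc, hc'⟩ := im_add_inv_eq_neg hz hz0
  have hE : (z + z⁻¹).im ≠ 0 := by rw [hc']; exact mul_ne_zero (by linarith) him
  refine ⟨fun h => him (hp z hz.le h).1, ?_⟩
  rw [hr z hz hz0 (mem_resolventSet_of_im_ne_zero hJ hE), RatFunc.eval_eq_div]

theorem num_denom_not_both_zero (r : RatFunc ℂ) (z : ℂ) :
    ¬ (r.denom.eval z = 0 ∧ r.num.eval z = 0) := by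
  rintro ⟨h1, h2⟩
  obtain ⟨a, b, hab⟩ := r.isCoprime_num_denom
  have := congrArg (eval z) hab
  simp [h1, h2] at this

/-- Along `z = it` the bound `|m(E)| ≤ 1 / |Im E|` makes `M` tend to `0`, so the numerator vanishes
at `0` and the denominator cannot. -/
theorem MFunctionIs.denom_eval_zero (hJ : IsSelfAdjoint J.operator) (hr : J.MFunctionIs r)
    (hp : PolesInDiskRealSimple r) : r.denom.eval 0 ≠ 0 := by
  intro h0
  refine num_denom_not_both_zero r 0 ⟨h0, ?_⟩
  have hγ : Continuous fun t : ℝ => (t * Complex.I : ℂ) := by fun_prop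
  have hc1 : Continuous fun t : ℝ => (1 - t ^ 2) * ‖r.num.eval (t * Complex.I : ℂ)‖ :=
    (by fun_prop : Continuous fun t : ℝ => 1 - t ^ 2).mul (r.num.continuous.comp hγ).norm
  have hc2 : Continuous fun t : ℝ => t * ‖r.denom.eval (t * Complex.I : ℂ)‖ :=
    continuous_id.mul (r.denom.continuous.comp hγ).norm
  have hle := le_of_tendsto_of_tendsto ((hc1.tendsto 0).mono_left nhdsWithin_le_nhds)
    ((hc2.tendsto 0).mono_left (nhdsWithin_le_nhds (s := Set.Ioi 0))) (by
      filter_upwards [Ioo_mem_nhdsGT (one_pos : (0 : ℝ) < 1)] with t ht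
      have hn : ‖(t * Complex.I : ℂ)‖ < 1 := by simpa [abs_of_pos ht.1] using ht.2
      obtain ⟨h1, h2⟩ := hr.eq_div hJ hp hn (by simpa using ht.1.ne')
      have h3 := norm_m_le hJ (E := (t * Complex.I + (t * Complex.I)⁻¹ : ℂ))
      have h4 : ‖J.m (t * Complex.I + (t * Complex.I)⁻¹ : ℂ)‖ =
          ‖r.num.eval (t * Complex.I : ℂ)‖ / ‖r.denom.eval (t * Complex.I : ℂ)‖ := by
        rw [← norm_div, ← h2, M, norm_neg]
      have hgt := (one_lt_inv₀ ht.1).2 ht.2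
      rw [h4, ← mul_div_assoc, div_le_one (norm_pos_iff.2 h1), im_add_inv_mul_I, abs_sub_comm,
        abs_of_pos (by linarith [ht.2])] at h3
      have h5 : (1 - t ^ 2) = t * (t⁻¹ - t) := by
        rw [mul_sub, mul_inv_cancel₀ ht.1.ne']; ring
      rw [h5, mul_assoc]
      exact mul_le_mul_of_nonneg_left h3 ht.1.le)
  simpa using hle

/-- A rational `M`-function has real coefficients. -/
theorem MFunctionIs.map_conj (hJ : IsSelfAdjoint J.operator) (hr : J.MFunctionIs r)
    (hp : PolesInDiskRealSimple r) :
    r.denom.map (starRingEnd ℂ) = r.denom ∧ r.num.map (starRingEnd ℂ) = r.num := by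
  have hpoly : r.num * r.denom.map (starRingEnd ℂ) = r.num.map (starRingEnd ℂ) * r.denom := by
    refine eq_of_eval_imaginary fun t ht ht1 => ?_
    have hz : ‖(t * Complex.I : ℂ)‖ < 1 := by simpa [abs_of_pos ht] using ht1
    have him : (t * Complex.I : ℂ).im ≠ 0 := by simpa using ht.ne'
    have hz0 : (t * Complex.I : ℂ) ≠ 0 := mul_I_ne_zero_of_pos ht
    generalize (t * Complex.I : ℂ) = z at hz him hz0
    obtain ⟨h1, h2⟩ := hr.eq_div hJ hp hz him
    obtain ⟨h3, h4⟩ := hr.eq_div hJ hp (z := starRingEnd ℂ z) (by rwa [RCLike.norm_conj])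
      (by simpa using him)
    obtain ⟨c, hc, hc'⟩ := im_add_inv_eq_neg hz hz0
    have hE : (z + z⁻¹).im ≠ 0 := by rw [hc']; exact mul_ne_zero (by linarith) him
    have h5 : J.M (starRingEnd ℂ z) = starRingEnd ℂ (J.M z) := by
      rw [M, M, map_neg, ← m_conj hJ hE, map_add, map_inv₀]
    have h6 : r.num.eval z / r.denom.eval z = starRingEnd ℂ (r.num.eval (starRingEnd ℂ z)) /
        starRingEnd ℂ (r.denom.eval (starRingEnd ℂ z)) := by
      rw [← h2, ← map_div₀, ← h4, h5, Complex.conj_conj]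
    rw [eval_mul, eval_mul, eval_map_conj, eval_map_conj]
    rwa [div_eq_div_iff h1 (by simpa using h3)] at h6
  have hD : r.denom.map (starRingEnd ℂ) = r.denom := by
    refine (eq_of_monic_of_dvd_of_natDegree_le r.monic_denom (r.monic_denom.map _) ?_ ?_)
    · exact r.isCoprime_num_denom.symm.dvd_of_dvd_mul_left ⟨_, by rw [hpoly, mul_comm]⟩
    · exact natDegree_map_le
  refine ⟨hD, ?_⟩
  rw [hD] at hpoly
  exact (mul_right_cancel₀ r.denom_ne_zero hpoly).symm

/-- Radial limit of the Herglotz property. Multiplying by the conjugate denominator instead of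
dividing keeps the limit meaningful at poles on the circle. -/
theorem MFunctionIs.im_nonneg (hJ : IsSelfAdjoint J.operator) (hr : J.MFunctionIs r)
    (hp : PolesInDiskRealSimple r) {ζ : ℂ} (hζ : ‖ζ‖ = 1) (him : 0 < ζ.im) :
    0 ≤ (r.num.eval ζ * starRingEnd ℂ (r.denom.eval ζ)).im := by
  have hγ : Continuous fun s : ℝ => (s * ζ : ℂ) := by fun_prop
  have hc : Continuous fun s : ℝ =>
      (r.num.eval (s * ζ) * starRingEnd ℂ (r.denom.eval (s * ζ))).im :=
    Complex.continuous_im.comp ((r.num.continuous.comp hγ).mul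
      (Complex.continuous_conj.comp (r.denom.continuous.comp hγ)))
  have h1 := ge_of_tendsto ((hc.tendsto 1).mono_left (nhdsWithin_le_nhds (s := Set.Iio 1)))
    (b := 0) (by
      filter_upwards [Ioo_mem_nhdsLT (one_pos : (0 : ℝ) < 1)] with s hs
      have hz : ‖(s * ζ : ℂ)‖ < 1 := by
        rw [norm_mul, hζ, mul_one, Complex.norm_real, Real.norm_of_nonneg hs.1.le]
        exact hs.2
      have hi : 0 < (s * ζ : ℂ).im := by
        rw [Complex.im_ofReal_mul]
        exact mul_pos hs.1 him
      generalize (s * ζ : ℂ) = z at hz hi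
      have hz0 : z ≠ 0 := by rintro rfl; simp at hi
      obtain ⟨c, hc, hc'⟩ := im_add_inv_eq_neg hz hz0
      have hm := m_im_nonpos hJ (E := z + z⁻¹) (by rw [hc']; nlinarith [mul_pos hc hi])
      obtain ⟨h2, h3⟩ := hr.eq_div hJ hp hz hi.ne'
      have h4 : r.num.eval z * starRingEnd ℂ (r.denom.eval z) =
          J.M z * (Complex.normSq (r.denom.eval z) : ℝ) := by
        rw [h3, ← Complex.mul_conj, ← mul_assoc, div_mul_cancel₀ _ h2]
      rw [h4, Complex.im_mul_ofReal, M, Complex.neg_im]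
      exact mul_nonneg (by linarith) (Complex.normSq_nonneg _))
  simpa using h1

end Rational

/-- A rational `M`-function with polynomial Jost function and canonical weights comes from a
finite-rank perturbation. -/
theorem finiteRank_of_rational (hJ : IsSelfAdjoint J.operator) {r : RatFunc ℂ}
    (hr : J.MFunctionIs r) (hp : PolesInDiskRealSimple r) {u : ℂ[X]}
    (hu : ∀ z : ℂ, ‖z‖ < 1 → jostFunction r z = u.eval z)
    (hcan : ∀ z₀ : ℂ, ‖z₀‖ < 1 → IsPole r z₀ → HasCanonicalWeight r u z₀) :
    J.FiniteRankPerturbation := by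
  rw [finiteRankPerturbation_iff]
  have hD0 := hr.denom_eval_zero hJ hp
  have hD := r.denom_ne_zero
  obtain ⟨hDr, hNr⟩ := hr.map_conj hJ hp
  have hDM : ∀ z : ℂ, ‖z‖ < 1 → z.im ≠ 0 → r.denom.eval z * J.M z = r.num.eval z := by
    intro z hz him
    obtain ⟨h1, h2⟩ := hr.eq_div hJ hp hz him
    rw [h2, mul_div_cancel₀ _ h1]
  have hconj : ∀ {p : ℂ[X]}, p.map (starRingEnd ℂ) = p → ∀ z,
      p.eval (starRingEnd ℂ z) = starRingEnd ℂ (p.eval z) := by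
    intro p hp z
    have h := eval_map_conj p (starRingEnd ℂ z)
    rwa [hp, Complex.conj_conj] at h
  have hreval : ∀ z, r.eval (RingHom.id ℂ) z = r.num.eval z / r.denom.eval z :=
    RatFunc.eval_eq_div r
  have hnonneg : ∀ ζ : ℂ, ‖ζ‖ = 1 →
      0 ≤ ζ.im * (r.num.eval ζ * starRingEnd ℂ (r.denom.eval ζ)).im := by
    intro ζ hζ
    rcases lt_trichotomy ζ.im 0 with h | h | h
    · have := hr.im_nonneg hJ hp (ζ := starRingEnd ℂ ζ) (by rwa [RCLike.norm_conj]) (by simpa using h)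
      rw [hconj hNr, hconj hDr, ← map_mul, Complex.conj_im] at this
      nlinarith
    · simp [h]
    · exact mul_nonneg h.le (hr.im_nonneg hJ hp hζ h)
  have hcop := num_denom_not_both_zero r
  have hcan' : ∀ z : ℂ, ‖z‖ < 1 → r.denom.eval z = 0 → HasCanonicalWeight r u z := hcan
  have hsimple : ∀ z : ℂ, ‖z‖ ≤ 1 → r.denom.eval z = 0 →
      z.im = 0 ∧ r.denom.derivative.eval z ≠ 0 := fun z hz h =>
    ⟨(hp z hz h).1, (rootMultiplicity_eq_one_iff hD h).1 (hp z hz h).2⟩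
  have huc := jost_conj (fun z => by
    rw [hreval, hreval, hconj hNr, hconj hDr, map_div₀]) hp hu
  have hzero : ∀ z : ℂ, ‖z‖ < 1 → (u.eval z = 0 ↔ r.denom.eval z = 0) := fun z hz => by
    rw [← hu z hz, jostFunction_eq_zero_iff hD0 hz]
  have hu0 : u ≠ 0 := by
    rintro rfl
    exact hD0 ((hzero 0 (by simp)).1 (by simp))
  set D := r.denom
  set N := r.num
  set n := max (max D.natDegree N.natDegree) u.natDegree with hn
  have hDn : D.natDegree ≤ n := (le_max_left _ _).trans (le_max_left _ _)
  have hNn : N.natDegree ≤ n := (le_max_right _ _).trans (le_max_left _ _)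
  have hun : u.natDegree ≤ n := le_max_right _ _
  set Q : ℂ[X] := N * D.reflect n - N.reflect n * D with hQdef
  have hQe : ∀ z : ℂ, z ≠ 0 →
      Q.eval z = z ^ n * (N.eval z * D.eval z⁻¹ - N.eval z⁻¹ * D.eval z) := by
    intro z hz
    rw [hQdef, eval_sub, eval_mul, eval_mul, eval_reflect hDn hz, eval_reflect hNn hz]
    ring
  -- `Q = 0` would be a vanishing Wronskian of `D` and `N`, which `eventually_free_of_wronskian`
  -- rules out.
  have hQ : Q ≠ 0 := by
    intro hQ0
    refine (eventually_free_of_wronskian hJ hD0 hDM (c := 0) fun z hz => ?_).1 rfl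
    have h := hQe z hz
    rw [hQ0, eval_zero, eq_comm, mul_eq_zero, or_iff_right (pow_ne_zero n hz)] at h
    linear_combination h
  have hcircle : ∀ ζ : ℂ, ‖ζ‖ = 1 → ζ ≠ 0 := by
    rintro _ h rfl
    simp at h
  have himsub : ∀ w : ℂ, w - starRingEnd ℂ w = 2 * w.im * Complex.I := fun w => by
    rw [Complex.sub_conj]; push_cast; ring
  have hQc : ∀ ζ : ℂ, ‖ζ‖ = 1 → N.eval ζ * D.eval ζ⁻¹ - N.eval ζ⁻¹ * D.eval ζ =
      2 * (N.eval ζ * starRingEnd ℂ (D.eval ζ)).im * Complex.I := by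
    intro ζ hζ
    rw [← himsub, inv_eq_conj_of_norm_eq_one hζ, hconj hNr, hconj hDr, map_mul, Complex.conj_conj]
  have hQn : ∀ ζ : ℂ, ‖ζ‖ = 1 →
      ‖Q.eval ζ‖ = 2 * |(N.eval ζ * starRingEnd ℂ (D.eval ζ)).im| := by
    intro ζ hζ
    rw [hQe ζ (hcircle ζ hζ), hQc ζ hζ, norm_mul, norm_pow, hζ, one_pow, one_mul, norm_mul,
      norm_mul, Complex.norm_I, Complex.norm_real, mul_one, Real.norm_eq_abs, Complex.norm_ofNat]
  -- Chosen so that `|A| / |Q| = |sin θ / Im M|` on the circle; `Real.log` ignores the sign.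
  set A : ℂ[X] := (X ^ 2 - 1) * D ^ 2 with hAdef
  have hX : (X ^ 2 - 1 : ℂ[X]) ≠ 0 := by
    intro h
    have := congrArg (eval 0) h
    simp at this
  have hA : A ≠ 0 := mul_ne_zero hX (pow_ne_zero 2 hD)
  have hAn : ∀ ζ : ℂ, ‖ζ‖ = 1 → ‖A.eval ζ‖ = 2 * |ζ.im| * ‖D.eval ζ‖ ^ 2 := by
    intro ζ hζ
    have h1 : ζ ^ 2 - 1 = ζ * (2 * ζ.im * Complex.I) := by
      rw [← himsub, mul_sub, Complex.mul_conj, Complex.normSq_eq_norm_sq, hζ]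
      push_cast
      ring
    rw [hAdef, eval_mul, eval_sub, eval_pow, eval_X, eval_one, eval_pow, h1, norm_mul, norm_mul,
      norm_mul, norm_mul, hζ, Complex.norm_I, Complex.norm_real, norm_pow, Real.norm_eq_abs,
      Complex.norm_ofNat]
    ring
  have hlog : ∀ ζ : ℂ, ‖ζ‖ = 1 → ζ ∉ ({ζ | A.eval ζ = 0} ∪ {ζ | Q.eval ζ = 0} : Set ℂ) →
      Real.log (ζ.im / (r.eval (RingHom.id ℂ) ζ).im) =
        Real.log ‖A.eval ζ‖ - Real.log ‖Q.eval ζ‖ := by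
    intro ζ hζ hζS
    simp only [Set.mem_union, Set.mem_ofPred_eq, not_or] at hζS
    have hA0 := norm_ne_zero_iff.2 hζS.1
    have hQ0 := norm_ne_zero_iff.2 hζS.2
    have hDζ : ‖D.eval ζ‖ ≠ 0 := by
      intro h
      rw [hAn ζ hζ, h] at hA0
      simp at hA0
    rw [← Real.log_div hA0 hQ0, ← Real.log_abs, hAn ζ hζ, hQn ζ hζ, hreval]
    congr 1
    have hdiv : (N.eval ζ / D.eval ζ).im =
        (N.eval ζ * starRingEnd ℂ (D.eval ζ)).im / ‖D.eval ζ‖ ^ 2 := by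
      rw [← Complex.normSq_eq_norm_sq, Complex.div_im, Complex.mul_im, Complex.conj_re,
        Complex.conj_im]
      ring
    rw [hdiv, abs_div, abs_div, abs_of_nonneg (sq_nonneg ‖D.eval ζ‖), div_div_eq_mul_div,
      mul_assoc, mul_div_mul_left _ _ two_ne_zero]
  have hnorm : ∀ ζ : ℂ, ‖ζ‖ = 1 → ‖u.eval ζ‖ ^ 2 * ‖Q.eval ζ‖ = ‖A.eval ζ‖ := fun ζ hζ =>
    norm_jost_sq hD0 hu hA hQ ((setOf_isRoot_finite hA).union (setOf_isRoot_finite hQ)) hlog hζ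
  have hcirc : ∀ ζ : ℂ, ‖ζ‖ = 1 → u.eval ζ * u.eval ζ⁻¹ *
      (N.eval ζ * D.eval ζ⁻¹ - N.eval ζ⁻¹ * D.eval ζ) =
        (ζ - ζ⁻¹) * (D.eval ζ * D.eval ζ⁻¹) := by
    intro ζ hζ
    have h1 := hnorm ζ hζ
    have h2 := hnonneg ζ hζ
    rw [hQn ζ hζ, hAn ζ hζ] at h1
    rw [hQc ζ hζ, inv_eq_conj_of_norm_eq_one hζ, huc, hconj hDr, himsub, Complex.mul_conj,
      Complex.mul_conj, Complex.normSq_eq_norm_sq, Complex.normSq_eq_norm_sq]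
    -- `hnorm` gives only absolute values; `hnonneg` supplies the matching signs.
    have h3 : ‖u.eval ζ‖ ^ 2 * (N.eval ζ * starRingEnd ℂ (D.eval ζ)).im =
        ζ.im * ‖D.eval ζ‖ ^ 2 := by
      generalize (N.eval ζ * starRingEnd ℂ (D.eval ζ)).im = x at h1 h2
      have hu2 := sq_nonneg ‖u.eval ζ‖
      have hd2 := sq_nonneg ‖D.eval ζ‖
      generalize ‖u.eval ζ‖ ^ 2 = a at h1 hu2 ⊢
      generalize ‖D.eval ζ‖ ^ 2 = b at h1 hd2 ⊢
      have h4 : a * |x| = |ζ.im| * b := by linarith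
      rcases le_or_gt 0 x with hx | hx
      · rcases hx.eq_or_lt with rfl | hx
        · rw [abs_zero, mul_zero] at h4
          rcases mul_eq_zero.1 h4.symm with h | h
          · rw [abs_eq_zero.1 h]; ring
          · rw [h]; ring
        · have h5 : 0 ≤ ζ.im := by nlinarith
          rwa [abs_of_pos hx, abs_of_nonneg h5] at h4
      · have h5 : ζ.im ≤ 0 := by nlinarith
        rw [abs_of_neg hx, abs_of_nonpos h5] at h4
        linarith
    have h3' := congrArg (fun x : ℝ => (x : ℂ)) h3
    push_cast at h3' ⊢
    linear_combination 2 * Complex.I * h3'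
  have hfull : X * u * u.reflect n * Q = X ^ n * (X ^ 2 - 1) * D * D.reflect n := by
    refine eq_of_infinite_eval_eq _ _ (sphere_infinite.mono fun ζ hζ => ?_)
    have hζ0 := hcircle ζ hζ
    rw [Set.mem_ofPred_eq]
    simp only [eval_mul, eval_sub, eval_pow, eval_X, eval_one]
    rw [eval_reflect hDn hζ0, eval_reflect hun hζ0, hQe ζ hζ0]
    have hzz : ζ * ζ⁻¹ = 1 := mul_inv_cancel₀ hζ0
    linear_combination ζ ^ n * ζ ^ n * ζ * hcirc ζ hζ -
      ζ ^ n * ζ ^ n * D.eval ζ * D.eval ζ⁻¹ * hzz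
  have hall : ∀ z : ℂ, z ≠ 0 → u.eval z * u.eval z⁻¹ *
      (N.eval z * D.eval z⁻¹ - N.eval z⁻¹ * D.eval z) =
        (z - z⁻¹) * (D.eval z * D.eval z⁻¹) := by
    intro z hz
    have h := congrArg (eval z) hfull
    simp only [eval_mul, eval_sub, eval_pow, eval_X, eval_one] at h
    rw [eval_reflect hDn hz, eval_reflect hun hz, hQe z hz] at h
    have hzz : z * z⁻¹ = 1 := mul_inv_cancel₀ hz
    apply mul_left_cancel₀ (mul_ne_zero (mul_ne_zero (pow_ne_zero n hz) (pow_ne_zero n hz)) hz)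
    linear_combination h + z ^ n * z ^ n * D.eval z * D.eval z⁻¹ * hzz
  obtain ⟨e, he⟩ : D ∣ u := by
    refine denom_dvd_of_canonical hcop hD hD0 hu0 hsimple hzero (fun z hz h => ?_) hall
    obtain ⟨h1, h2⟩ := hcan' z hz h
    refine ⟨h1, ?_⟩
    simp only [hreval] at h2
    have h3 := tendsto_nhds_unique h2 (tendsto_sub_mul_div h (hsimple z hz.le h).2)
    rw [← div_eq_mul_inv, div_eq_div_iff h1 (hsimple z hz.le h).2] at h3
    exact h3.symm
  -- Cancelling `D` and its reflection leaves the Wronskian relation for `u = D e` and `e N`, with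
  -- constant `1`.
  have hwr : X * e * e.reflect n * Q = X ^ n * X ^ n * (X ^ 2 - 1) := by
    have hen : e.natDegree ≤ n := by
      have he0 : e ≠ 0 := right_ne_zero_of_mul (he ▸ hu0)
      have := natDegree_mul hD he0
      rw [← he] at this
      omega
    apply mul_left_cancel₀ (mul_ne_zero hD (reflect_eq_zero_iff.not.2 hD))
    refine eq_of_eval_ne_zero fun z hz => ?_
    simp only [eval_mul, eval_sub, eval_pow, eval_X, eval_one]
    rw [eval_reflect hDn hz, eval_reflect hen hz, hQe z hz]
    have h := hall z hz
    rw [he, eval_mul, eval_mul] at h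
    have hzz : z * z⁻¹ = 1 := mul_inv_cancel₀ hz
    linear_combination z ^ n * z ^ n * z ^ n * z * h -
      z ^ n * z ^ n * z ^ n * D.eval z * D.eval z⁻¹ * hzz
  refine (eventually_free_of_wronskian hJ (U := u) (V := e * N) (c := 1)
    (fun h => hD0 ((hzero 0 (by simp)).1 h)) (fun z hz him => ?_) fun z hz => ?_).2
  · rw [he, eval_mul, eval_mul, ← hDM z hz him]
    ring
  · have hen : e.natDegree ≤ n := by
      have he0 : e ≠ 0 := right_ne_zero_of_mul (he ▸ hu0)
      have := natDegree_mul hD he0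
      rw [← he] at this
      omega
    have h := congrArg (eval z) hwr
    simp only [eval_mul, eval_sub, eval_pow, eval_X, eval_one] at h
    rw [eval_reflect hen hz, hQe z hz] at h
    have hzz : z * z⁻¹ = 1 := mul_inv_cancel₀ hz
    rw [he, eval_mul, eval_mul, eval_mul, eval_mul]
    apply mul_left_cancel₀ (mul_ne_zero (mul_ne_zero (pow_ne_zero n hz) (pow_ne_zero n hz)) hz)
    linear_combination h + z ^ n * z ^ n * hzz

end JacobiMatrix

end

theorem theorem4p1 (J : JacobiMatrix) (hJ : IsSelfAdjoint J.operator) :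
    J.FiniteRankPerturbation ↔
      ∃ r : RatFunc ℂ, J.MFunctionIs r ∧ PolesInDiskRealSimple r ∧
        ∃ u : ℂ[X], (∀ z : ℂ, ‖z‖ < 1 → jostFunction r z = u.eval z) ∧
          ∀ z₀ : ℂ, ‖z₀‖ < 1 → IsPole r z₀ → HasCanonicalWeight r u z₀ :=
  ⟨JacobiMatrix.exists_rational_of_finiteRank hJ, fun ⟨_, hr, hp, _, hu, hcan⟩ =>
    JacobiMatrix.finiteRank_of_rational hJ hr hp hu hcan⟩
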